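/- **Setting.** Let $\tilde{\mathcal A}=\{\sum_{\nu\ge 0}P_\nu(a)b^\nu : P_\nu\in\mathbb C[z]\}$ be the algebra with $ab-ba=b^2$ (multiplication by $a$ being continuous for the $b$-adic topology); it contains $\mathbb C[[b]]$. An $(a,b)$-module is a left $\tilde{\mathcal A}$-module which is free of finite type over $\mathbb C[[b]]$; its rank is its rank over $\mathbb C[[b]]$. Let $\Xi$ be the space of formal series $$\sum_{0\le j\le N}\ \sum_{\alpha\in A}T_{j,\alpha}(s)\,s^{\alpha}\frac{(\log s)^j}{j!},\qquad T_{j,\alpha}\in\mathbb C[[s]],\ N\in\mathbb N,\ A\subset\mathbb Q\cap\,]-1,+\infty[\ \text{finite},$$ made into a left $\tilde{\mathcal A}$-module by letting $a$ act as multiplication by $s$ and $b$ as the primitive without constant. For an $\tilde{\mathcal A}$-submodule $E\subset\Xi$, let $E^\sharp$ be its saturation by $b^{-1}a$, i.e. the smallest $\mathbb C[[b]]$-submodule containing $E$ and stable by $b^{-1}a$. $E$ is regular if $E^\sharp$ is of finite type over $\mathbb C[[b]]$; then its Bernstein polynomial $B_E$ is the characteristic polynomial of $-b^{-1}a$ acting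 on $E^\sharp/bE^\sharp$. A canonical form of $\varphi\in\Xi$ is an expression $\varphi=\sum_{(\alpha,j)\in A_\varphi}S_{\alpha,j}(b)\,s^\alpha\frac{(\log s)^j}{j!}$ with $A_\varphi\subset(\mathbb Q\,\cap\,]-1,+\infty[)\times\mathbb N$ finite and $S_{\alpha,j}\in\mathbb C[[b]]$, such that (i) $(\alpha,j)\in A_\varphi$ implies $(\alpha,i)\in A_\varphi$ for $0\le i\le j$; (ii) for $(\alpha,j)\in A_\varphi$, either $S_{\alpha,j}=0$ or $S_{\alpha,j}(0)\ne0$; (iii) for $(\alpha,j)\in A_\varphi$ there is $k\ge j$ with $(\alpha,k)\in A_\varphi$ and $S_{\alpha,k}(0)\neq0$; (iv) if $(\alpha,j)\in A_\varphi$, $S_{\alpha,j}\ne0$ and $(\alpha+p,j)\in A_\varphi$ with an integer $p\ge1$, then $S_{\alpha+p,j}=0$. For a class $\Lambda\in\mathbb Q/\mathbb Z$ of some $\alpha$ with $(\alpha,j)\in A_\varphi$, let $n(\Lambda)$ be the largest $j$ such that $S_{\alpha,j}(0)\ne0$ for some $(\alpha,j)\in A_\varphi$ with $\alpha\in\Lambda$,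 and let $\Lambda^+$ be the largest $\alpha\in\Lambda$ with $(\alpha,n(\Lambda))\in A_\varphi$ and $S_{\alpha,n(\Lambda)}(0)\ne0$. **Proposition.** Let $\varphi\in\Xi$, written in canonical form as above. Then $E:=\tilde{\mathcal A}\varphi\subset\Xi$ is a regular $(a,b)$-module, and its rank is $$\operatorname{rk}(E)=\sum_{\Lambda}\,(n(\Lambda)+1),$$ the sum being over the finitely many classes $\Lambda\in\mathbb Q/\mathbb Z$ of the exponents $\alpha$ with $(\alpha,j)\in A_\varphi$. For each such $\Lambda$, the Bernstein polynomial $B_E$ has exactly $n(\Lambda)+1$ roots, counted with multiplicity, in the class $-\Lambda$. Moreover $-(\Lambda^++1)$ is a root of $B_E$. -/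

import Mathlib

noncomputable section

namespace ABMod

/-! ## Operators `a`, `b` with `ab - ba = b²` -/

section Generic

variable {M : Type*} [AddCommGroup M] [Module ℂ M]

/-- The partial sum `∑_{i < N} bⁱ Fᵢ(a) x` for two operators `a`, `b` on `M`. -/
def partialSum (a b : Module.End ℂ M) (F : ℕ → Polynomial ℂ) (x : M) (N : ℕ) : M :=
  ∑ i ∈ Finset.range N, (b ^ i) (Polynomial.aeval a (F i) x)

theorem partialSum_succ (a b : Module.End ℂ M) (F : ℕ → Polynomial ℂ) (x : M) (N : ℕ) :
    partialSum a b F x (N + 1) =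
      partialSum a b F x N + (b ^ N) (Polynomial.aeval a (F N) x) :=
  Finset.sum_range_succ _ _

theorem comm_pow (a b : Module.End ℂ M) (h : ∀ x, a (b x) = b (a x) + b (b x)) (i : ℕ) (x : M) :
    a ((b ^ i) x) = (b ^ i) (a x) + (i : ℂ) • (b ^ (i + 1)) x := by
  induction i generalizing x with
  | zero => simp
  | succ i ih =>
    have e : ∀ (n : ℕ) (y : M), (b ^ (n + 1)) y = b ((b ^ n) y) := fun n y => by
      rw [pow_succ', Module.End.mul_apply]
    rw [e i, h, ih, e i (a x), e (i + 1)]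
    simp only [map_add, map_smul, e]
    push_cast
    module

end Generic

/-! ## The algebra `Ã` -/

/-- The algebra `Ã`: an element `F` is the formal series `∑ₙ bⁿ Fₙ(a)`, where the
`Fₙ = F.coeff n` are arbitrary polynomials.  Since `P(a) bⁿ` is a finite sum of terms `bᵐ Q(a)`
with `m ≥ n`, and conversely, these are the same formal series as the `∑ₙ Pₙ(a) bⁿ`. -/
@[ext] structure ATilde where
  coeff : ℕ → Polynomial ℂ

namespace ATilde

instance : Zero ATilde := ⟨⟨0⟩⟩
instance : Add ATilde := ⟨fun F G => ⟨F.coeff + G.coeff⟩⟩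
instance : Neg ATilde := ⟨fun F => ⟨-F.coeff⟩⟩
instance : Sub ATilde := ⟨fun F G => ⟨F.coeff - G.coeff⟩⟩
instance : SMul ℕ ATilde := ⟨fun c F => ⟨c • F.coeff⟩⟩
instance : SMul ℤ ATilde := ⟨fun c F => ⟨c • F.coeff⟩⟩
instance : SMul ℂ ATilde := ⟨fun c F => ⟨c • F.coeff⟩⟩

theorem coeff_injective : Function.Injective ATilde.coeff := fun _ _ => ATilde.ext

instance : AddCommGroup ATilde :=
  coeff_injective.addCommGroup ATilde.coeff rfl (fun _ _ => rfl) (fun _ => rfl) (fun _ _ => rfl)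
    (fun _ _ => rfl) (fun _ _ => rfl)

/-- The family of coefficients, as an additive map. -/
def coeffHom : ATilde →+ (ℕ → Polynomial ℂ) where
  toFun := ATilde.coeff
  map_zero' := rfl
  map_add' _ _ := rfl

instance : Module ℂ ATilde := coeff_injective.module ℂ coeffHom (fun _ _ => rfl)

theorem ext_coeff {F G : ATilde} (h : ∀ n, F.coeff n = G.coeff n) : F = G :=
  ATilde.ext (funext h)

@[simp] theorem coeff_add (F G : ATilde) (n : ℕ) : (F + G).coeff n = F.coeff n + G.coeff n := rfl
@[simp] theorem coeff_smul (c : ℂ) (F : ATilde) (n : ℕ) : (c • F).coeff n = c • F.coeff n := rfl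
@[simp] theorem coeff_zero (n : ℕ) : (0 : ATilde).coeff n = 0 := rfl

/-- The coefficient of index `n` as a linear map. -/
def coeffLinear (n : ℕ) : ATilde →ₗ[ℂ] Polynomial ℂ where
  toFun F := F.coeff n
  map_add' _ _ := rfl
  map_smul' _ _ := rfl

/-- The element `P(a)` of `Ã`. -/
def ofPoly (P : Polynomial ℂ) : ATilde := ⟨fun n => Nat.casesOn n P (fun _ => 0)⟩

@[simp] theorem coeff_ofPoly_zero (P : Polynomial ℂ) : (ofPoly P).coeff 0 = P := rfl
@[simp] theorem coeff_ofPoly_succ (P : Polynomial ℂ) (n : ℕ) : (ofPoly P).coeff (n + 1) = 0 := rfl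

/-- Left multiplication by `b`:  `b · ∑ bⁿ Fₙ(a) = ∑ bⁿ⁺¹ Fₙ(a)`. -/
def opB : Module.End ℂ ATilde where
  toFun F := ⟨fun n => Nat.casesOn n 0 (fun m => F.coeff m)⟩
  map_add' F G := by apply ext_coeff; rintro (_ | n) <;> simp
  map_smul' c F := by apply ext_coeff; rintro (_ | n) <;> simp

/-- Left multiplication by `a`: since `a bⁿ = bⁿ a + n bⁿ⁺¹`,
`a · ∑ bⁿ Fₙ(a) = ∑ (bⁿ a Fₙ(a) + n bⁿ⁺¹ Fₙ(a))`. -/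
def opA : Module.End ℂ ATilde where
  toFun F := ⟨fun n => Polynomial.X * F.coeff n + Nat.casesOn n 0 (fun m => (m : ℂ) • F.coeff m)⟩
  map_add' F G := by
    apply ext_coeff
    rintro (_ | n)
    · simp [mul_add]
    · simp [mul_add]; ring
  map_smul' c F := by apply ext_coeff; rintro (_ | n) <;> simp [smul_comm _ c]

@[simp] theorem coeff_opB_zero (F : ATilde) : (opB F).coeff 0 = 0 := rfl
@[simp] theorem coeff_opB_succ (F : ATilde) (n : ℕ) : (opB F).coeff (n + 1) = F.coeff n := rfl
@[simp] theorem coeff_opA_zero (F : ATilde) :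
    (opA F).coeff 0 = Polynomial.X * F.coeff 0 := by
  change _ + _ = _; simp
@[simp] theorem coeff_opA_succ (F : ATilde) (n : ℕ) :
    (opA F).coeff (n + 1) = Polynomial.X * F.coeff (n + 1) + (n : ℂ) • F.coeff n := rfl

theorem opA_opB (F : ATilde) : opA (opB F) = opB (opA F) + opB (opB F) := by
  apply ext_coeff
  rintro (_ | _ | n)
  · simp
  · simp
  · simp only [coeff_opA_succ, coeff_opB_succ, coeff_add]
    push_cast
    module

theorem coeff_opB_pow (i n : ℕ) (F : ATilde) :
    ((opB ^ i) F).coeff n = if n < i then 0 else F.coeff (n - i) := by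
  induction i generalizing n with
  | zero => simp
  | succ i ih =>
    rw [pow_succ', Module.End.mul_apply]
    cases n with
    | zero => simp
    | succ n => simp [ih]

/-- The product `F · G = ∑ᵢ bⁱ Fᵢ(a) G`, computed with the left multiplications by `a` and `b`;
the terms with `i > n` do not contribute to the coefficient of index `n`. -/
instance : Mul ATilde :=
  ⟨fun F G => ⟨fun n => (partialSum opA opB F.coeff G (n + 1)).coeff n⟩⟩

instance : One ATilde := ⟨ofPoly 1⟩

@[simp] theorem coeff_one_zero : (1 : ATilde).coeff 0 = 1 := rfl
@[simp] theorem coeff_one_succ (n : ℕ) : (1 : ATilde).coeff (n + 1) = 0 := rfl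

theorem coeff_mul (F G : ATilde) (n : ℕ) :
    (F * G).coeff n = (partialSum opA opB F.coeff G (n + 1)).coeff n := rfl

theorem coeff_mul_of_lt (F G : ATilde) {n N : ℕ} (h : n < N) :
    (F * G).coeff n = (partialSum opA opB F.coeff G N).coeff n := by
  induction N, h using Nat.le_induction with
  | base => rfl
  | succ N hN ih =>
    rw [partialSum_succ, coeff_add, ← ih, coeff_opB_pow, if_pos (by omega), add_zero]

end ATilde

section Generic

variable {M : Type*} [AddCommGroup M] [Module ℂ M]

open ATilde

theorem partialSum_add (a b : Module.End ℂ M) (F G : ATilde) (x : M) (N : ℕ) :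
    partialSum a b (F + G).coeff x N = partialSum a b F.coeff x N + partialSum a b G.coeff x N := by
  simp [partialSum, Finset.sum_add_distrib]

theorem partialSum_smul (a b : Module.End ℂ M) (c : ℂ) (F : ATilde) (x : M) (N : ℕ) :
    partialSum a b (c • F).coeff x N = c • partialSum a b F.coeff x N := by
  simp [partialSum, Finset.smul_sum]

theorem partialSum_add_right (a b : Module.End ℂ M) (F : ℕ → Polynomial ℂ) (x y : M) (N : ℕ) :
    partialSum a b F (x + y) N = partialSum a b F x N + partialSum a b F y N := by
  simp [partialSum, Finset.sum_add_distrib]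

theorem partialSum_zero_right (a b : Module.End ℂ M) (F : ℕ → Polynomial ℂ) (N : ℕ) :
    partialSum a b F 0 N = 0 := by
  simp [partialSum]

theorem partialSum_one (a b : Module.End ℂ M) (x : M) (N : ℕ) :
    partialSum a b (1 : ATilde).coeff x (N + 1) = x := by
  rw [partialSum, Finset.sum_range_succ']
  simp

theorem partialSum_opB (a b : Module.End ℂ M) (F : ATilde) (x : M) (N : ℕ) :
    partialSum a b (opB F).coeff x (N + 1) = b (partialSum a b F.coeff x N) := by
  rw [partialSum, Finset.sum_range_succ', partialSum, map_sum]
  simp [pow_succ']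

theorem partialSum_opA (a b : Module.End ℂ M) (h : ∀ x, a (b x) = b (a x) + b (b x))
    (F : ATilde) (x : M) (N : ℕ) :
    partialSum a b (opA F).coeff x (N + 1) =
      a (partialSum a b F.coeff x N) + (b ^ N) (a (Polynomial.aeval a (F.coeff N) x)) := by
  induction N with
  | zero => simp [partialSum]
  | succ N ih =>
    rw [partialSum_succ, ih, partialSum_succ, map_add, comm_pow a b h, coeff_opA_succ]
    simp only [map_add, map_mul, Polynomial.aeval_X, Module.End.mul_apply, LinearMap.add_apply,
      map_smul, LinearMap.smul_apply]
    module

theorem aeval_opA_one (P : Polynomial ℂ) : Polynomial.aeval opA P (1 : ATilde) = ofPoly P := by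
  induction P using Polynomial.induction_on with
  | C c =>
    apply ext_coeff
    rintro (_ | n) <;> simp [Polynomial.smul_eq_C_mul]
  | add p q hp hq =>
    rw [map_add, LinearMap.add_apply, hp, hq]
    apply ext_coeff
    rintro (_ | n) <;> simp
  | monomial n c ih =>
    rw [pow_succ', mul_left_comm, map_mul, Module.End.mul_apply, ih, Polynomial.aeval_X]
    apply ext_coeff
    rintro (_ | _ | n) <;> simp

theorem eq_partialSum (F : ATilde) (N : ℕ) :
    F = partialSum opA opB F.coeff (1 : ATilde) N + (opB ^ N) ⟨fun n => F.coeff (n + N)⟩ := by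
  induction N with
  | zero => simp [partialSum]
  | succ N ih =>
    conv_lhs => rw [ih]
    rw [partialSum_succ, add_assoc, pow_succ, Module.End.mul_apply, ← map_add, aeval_opA_one]
    congr 2
    apply ext_coeff
    rintro (_ | m)
    · simp
    · simp [add_assoc, add_comm 1 N]

/-- A linear map out of `Ã` which commutes with `a` and `b` is determined by the image of `1`,
when the target is separated for the `b`-adic filtration. -/
theorem intertwiner_ext {a b : Module.End ℂ M}
    (hsep : ∀ x : M, (∀ N : ℕ, ∃ y, x = (b ^ N) y) → x = 0)
    {S T : ATilde →ₗ[ℂ] M} (hSa : ∀ F, S (opA F) = a (S F)) (hSb : ∀ F, S (opB F) = b (S F))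
    (hTa : ∀ F, T (opA F) = a (T F)) (hTb : ∀ F, T (opB F) = b (T F)) (h1 : S 1 = T 1) :
    S = T := by
  have hpow : ∀ (U : ATilde →ₗ[ℂ] M), (∀ F, U (opB F) = b (U F)) →
      ∀ (i : ℕ) (F : ATilde), U ((opB ^ i) F) = (b ^ i) (U F) := by
    intro U hU i
    induction i with
    | zero => simp
    | succ i ih => intro F; rw [pow_succ', Module.End.mul_apply, hU, ih, pow_succ']; rfl
  have hae : ∀ (U : ATilde →ₗ[ℂ] M), (∀ F, U (opA F) = a (U F)) →
      ∀ (p : Polynomial ℂ) (F : ATilde),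
        U (Polynomial.aeval opA p F) = Polynomial.aeval a p (U F) := by
    intro U hU p F
    induction p using Polynomial.induction_on with
    | C c => simp
    | add p q hp hq => simp [hp, hq]
    | monomial n c ih =>
      rw [pow_succ', mul_left_comm, map_mul, Module.End.mul_apply, Polynomial.aeval_X, hU, ih,
        map_mul _ Polynomial.X, Module.End.mul_apply, Polynomial.aeval_X]
  ext1 F
  rw [← sub_eq_zero]
  apply hsep
  intro N
  refine ⟨S ⟨fun n => F.coeff (n + N)⟩ - T ⟨fun n => F.coeff (n + N)⟩, ?_⟩
  have key : S (partialSum opA opB F.coeff 1 N) = T (partialSum opA opB F.coeff 1 N) := by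
    simp only [partialSum, map_sum, hpow S hSb, hpow T hTb, hae S hSa, hae T hTa, h1]
  conv_lhs => rw [eq_partialSum F N]
  rw [map_add, map_add, key, hpow S hSb, hpow T hTb, map_sub]
  abel

end Generic

namespace ATilde

theorem opB_sep (F : ATilde) (h : ∀ N : ℕ, ∃ G, F = (opB ^ N) G) : F = 0 := by
  apply ext_coeff
  intro n
  obtain ⟨G, hG⟩ := h (n + 1)
  rw [hG, coeff_opB_pow, if_pos (Nat.lt_succ_self n), coeff_zero]

/-- Right multiplication by `G` as a linear map. -/
def mulRight (G : ATilde) : ATilde →ₗ[ℂ] ATilde where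
  toFun F := F * G
  map_add' F F' := by apply ext_coeff; intro n; simp only [coeff_mul, partialSum_add, coeff_add]
  map_smul' c F := by
    apply ext_coeff; intro n; simp only [coeff_mul, partialSum_smul, coeff_smul, RingHom.id_apply]

theorem opB_mul (F G : ATilde) : opB F * G = opB (F * G) := by
  apply ext_coeff
  rintro (_ | n)
  · rw [coeff_mul, partialSum_opB]; simp
  · rw [coeff_mul, partialSum_opB, coeff_opB_succ, coeff_opB_succ, coeff_mul]

theorem opA_mul (F G : ATilde) : opA F * G = opA (F * G) := by
  apply ext_coeff
  intro n
  rw [coeff_mul_of_lt _ _ (show n < n + 1 + 1 by omega), partialSum_opA _ _ opA_opB, coeff_add,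
    coeff_opB_pow, if_pos (by omega), add_zero]
  cases n with
  | zero => rw [coeff_opA_zero, coeff_opA_zero, coeff_mul]
  | succ n =>
    rw [coeff_opA_succ, coeff_opA_succ, coeff_mul, coeff_mul_of_lt F G (show n < n + 1 + 1 by omega)]

theorem one_mul_aux (G : ATilde) : 1 * G = G := by
  apply ext_coeff
  intro n
  rw [coeff_mul, partialSum_one]

theorem mul_one_aux (F : ATilde) : F * 1 = F := by
  have : mulRight 1 = LinearMap.id := intertwiner_ext opB_sep (fun F => opA_mul F 1)
    (fun F => opB_mul F 1) (fun _ => rfl) (fun _ => rfl) (one_mul_aux 1)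
  exact LinearMap.congr_fun this F

theorem mul_assoc_aux (F G H : ATilde) : F * G * H = F * (G * H) := by
  have : (mulRight H).comp (mulRight G) = mulRight (G * H) := by
    refine intertwiner_ext opB_sep (a := opA) (b := opB) ?_ ?_ (fun F => opA_mul F _)
      (fun F => opB_mul F _) ?_
    · intro F
      change opA F * G * H = opA (F * G * H)
      rw [opA_mul, opA_mul]
    · intro F
      change opB F * G * H = opB (F * G * H)
      rw [opB_mul, opB_mul]
    · change 1 * G * H = 1 * (G * H)
      rw [one_mul_aux, one_mul_aux]
  exact LinearMap.congr_fun this F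

instance : Ring ATilde :=
  { (inferInstance : AddCommGroup ATilde), (inferInstance : Mul ATilde),
    (inferInstance : One ATilde) with
    one_mul := one_mul_aux
    mul_one := mul_one_aux
    mul_assoc := mul_assoc_aux
    left_distrib := fun F G H => by
      apply ext_coeff; intro n; simp only [coeff_mul, partialSum_add_right, coeff_add]
    right_distrib := fun F G H => (mulRight H).map_add F G
    zero_mul := fun F => (mulRight F).map_zero
    mul_zero := fun F => by
      apply ext_coeff; intro n; rw [coeff_mul, partialSum_zero_right] }

/-- The element `a` of `Ã`. -/
def a : ATilde := ofPoly Polynomial.X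

/-- The element `b` of `Ã`. -/
def b : ATilde := opB 1

theorem opA_one : opA 1 = a := by
  apply ext_coeff
  rintro (_ | _ | n) <;> simp [a]

theorem a_mul (F : ATilde) : a * F = opA F := by rw [← opA_one, opA_mul, one_mul]
theorem b_mul (F : ATilde) : b * F = opB F := by rw [b, opB_mul, one_mul]

theorem a_mul_b : a * b - b * a = b ^ 2 := by
  rw [a_mul, b_mul, pow_two, b_mul, b, opA_opB, opA_one]
  abel

/-- The subalgebra `ℂ[[b]]` of `Ã`. -/
def ofPowerSeries : PowerSeries ℂ →+* ATilde where
  toFun S := ⟨fun n => Polynomial.C (PowerSeries.coeff n S)⟩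
  map_one' := by
    apply ext_coeff
    rintro (_ | n) <;> simp [PowerSeries.coeff_one]
  map_zero' := by apply ext_coeff; intro n; simp
  map_add' S T := by apply ext_coeff; intro n; simp
  map_mul' S T := by
    apply ext_coeff
    intro n
    rw [coeff_mul]
    simp only [partialSum, Polynomial.aeval_C]
    change _ = coeffLinear n (Finset.sum _ _)
    rw [map_sum, PowerSeries.coeff_mul,
      Finset.Nat.sum_antidiagonal_eq_sum_range_succ_mk, map_sum]
    refine Finset.sum_congr rfl fun i hi => ?_
    have hi' : ¬ n < i := by have := Finset.mem_range.1 hi; omega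
    change _ = ((opB ^ i) _).coeff n
    rw [coeff_opB_pow, if_neg hi']
    simp [Module.algebraMap_end_apply, Polynomial.smul_eq_C_mul]

theorem coeff_ofPowerSeries (S : PowerSeries ℂ) (n : ℕ) :
    (ofPowerSeries S).coeff n = Polynomial.C (PowerSeries.coeff n S) := rfl

theorem ofPowerSeries_X : ofPowerSeries PowerSeries.X = b := by
  apply ext_coeff
  rintro (_ | _ | n) <;> simp [coeff_ofPowerSeries, b, PowerSeries.coeff_X]

theorem ofPowerSeries_smul (c : ℂ) (S : PowerSeries ℂ) :
    ofPowerSeries (c • S) = c • ofPowerSeries S := by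
  apply ext_coeff
  intro n
  simp [coeff_ofPowerSeries, Polynomial.smul_eq_C_mul]

theorem smul_mul_aux (c : ℂ) (F G : ATilde) : (c • F) * G = c • (F * G) :=
  (mulRight G).map_smul c F

instance : Module (PowerSeries ℂ) ATilde := Module.compHom ATilde ofPowerSeries

theorem powerSeries_smul_def (S : PowerSeries ℂ) (F : ATilde) : S • F = ofPowerSeries S * F := rfl

end ATilde

/-! ## Standard asymptotic expansions -/

/-- The inverse of the operator `β + d/dL` on polynomials in `L`, for `β ≠ 0`:
`∑ᵢ (-1)ⁱ β⁻⁽ⁱ⁺¹⁾ (d/dL)ⁱ`. -/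
def logInvFun (β : ℂ) (p : Polynomial ℂ) : Polynomial ℂ :=
  ∑ i ∈ Finset.range (p.natDegree + 1),
    ((-1) ^ i * (β⁻¹) ^ (i + 1)) • (Polynomial.derivative^[i] p)

theorem logInvFun_eq (β : ℂ) (p : Polynomial ℂ) {N : ℕ} (h : p.natDegree < N) :
    logInvFun β p = ∑ i ∈ Finset.range N,
      ((-1) ^ i * (β⁻¹) ^ (i + 1)) • (Polynomial.derivative^[i] p) := by
  refine Finset.sum_subset (fun i hi => ?_) (fun i _ hi => ?_)
  · simp only [Finset.mem_range] at hi ⊢; omega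
  · rw [Polynomial.iterate_derivative_eq_zero, smul_zero]
    simp only [Finset.mem_range] at hi; omega

/-- `logInvFun` as a linear map. -/
def logInv (β : ℂ) : Module.End ℂ (Polynomial ℂ) where
  toFun := logInvFun β
  map_add' p q := by
    set N := max (max p.natDegree q.natDegree) (p + q).natDegree + 1 with hN
    rw [logInvFun_eq β p (N := N) (by omega), logInvFun_eq β q (N := N) (by omega),
      logInvFun_eq β (p + q) (N := N) (by omega), ← Finset.sum_add_distrib]
    exact Finset.sum_congr rfl fun i _ => by
      rw [iterate_map_add, smul_add]
  map_smul' c p := by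
    set N := max p.natDegree (c • p).natDegree + 1 with hN
    rw [logInvFun_eq β p (N := N) (by omega), logInvFun_eq β (c • p) (N := N) (by omega),
      RingHom.id_apply, Finset.smul_sum]
    exact Finset.sum_congr rfl fun i _ => by
      rw [Polynomial.iterate_derivative_smul, smul_comm]

theorem logInv_apply (β : ℂ) (p : Polynomial ℂ) : logInv β p = logInvFun β p := rfl

theorem logInv_derivative (β : ℂ) (p : Polynomial ℂ) :
    logInv β (Polynomial.derivative p) = Polynomial.derivative (logInv β p) := by
  rw [logInv_apply, logInv_apply,
    logInvFun_eq β p (N := p.natDegree + 1) (by omega),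
    logInvFun_eq β (Polynomial.derivative p) (N := p.natDegree + 1)
      (by have := Polynomial.natDegree_derivative_le p; omega), Polynomial.derivative_sum]
  exact Finset.sum_congr rfl fun i _ => by
    rw [Polynomial.derivative_smul, ← Function.iterate_succ_apply, Function.iterate_succ_apply']

theorem add_derivative_logInv {β : ℂ} (hβ : β ≠ 0) (p : Polynomial ℂ) :
    β • logInv β p + Polynomial.derivative (logInv β p) = p := by
  rw [logInv_apply, logInvFun, Finset.smul_sum, Polynomial.derivative_sum]
  have key : ∀ N : ℕ, (∑ i ∈ Finset.range N,
      β • ((-1) ^ i * (β⁻¹) ^ (i + 1)) • (Polynomial.derivative^[i] p)) +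
      (∑ i ∈ Finset.range N, Polynomial.derivative
        (((-1) ^ i * (β⁻¹) ^ (i + 1)) • (Polynomial.derivative^[i] p))) =
      p - ((-1) ^ N * (β⁻¹) ^ N) • (Polynomial.derivative^[N] p) := by
    intro N
    induction N with
    | zero => simp
    | succ N ih =>
      rw [Finset.sum_range_succ, Finset.sum_range_succ, add_add_add_comm, ih,
        Polynomial.derivative_smul, ← Function.iterate_succ_apply' Polynomial.derivative, smul_smul,
        show β * ((-1) ^ N * β⁻¹ ^ (N + 1)) = (-1) ^ N * β⁻¹ ^ N by
          rw [pow_succ]; field_simp]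
      rw [pow_succ (-1 : ℂ) N]
      module
  rw [key, Polynomial.iterate_derivative_eq_zero (by omega), smul_zero, sub_zero]

theorem logInv_add_derivative {β : ℂ} (hβ : β ≠ 0) (p : Polynomial ℂ) :
    logInv β (β • p + Polynomial.derivative p) = p := by
  rw [map_add, map_smul, logInv_derivative, add_derivative_logInv hβ]

theorem natDegree_logInv_le (β : ℂ) (p : Polynomial ℂ) :
    (logInv β p).natDegree ≤ p.natDegree := by
  rw [logInv_apply, logInvFun]
  refine Polynomial.natDegree_sum_le_of_forall_le _ _ fun i _ => ?_
  exact (Polynomial.natDegree_smul_le _ _).trans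
    ((Polynomial.natDegree_iterate_derivative p i).trans (Nat.sub_le _ _))

theorem logInv_sub {β : ℂ} (h0 : β ≠ 0) (h1 : β - 1 ≠ 0) (p : Polynomial ℂ) :
    logInv (β - 1) p = logInv β p + logInv β (logInv (β - 1) p) := by
  have h2 := logInv_add_derivative h0 (logInv (β - 1) p)
  have h3 := add_derivative_logInv h1 p
  have h4 : p + logInv (β - 1) p =
      β • logInv (β - 1) p + Polynomial.derivative (logInv (β - 1) p) := by
    nth_rewrite 1 [← h3]
    module
  rw [← map_add, h4, h2]

/-- The condition on a family `(ξ_α)_{α ∈ ℚ}` of polynomials, standing for the formal series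
`∑_α ξ_α(Log s) s^α`, to be a standard asymptotic expansion: the degrees in `Log s` are bounded
and the exponents `α` which occur lie in `A + ℕ` for a finite set `A ⊆ ℚ ∩ ]-1, +∞[`.
In other words the series is `∑_{j ≤ N, α ∈ A} T_{j,α}(s) s^α (Log s)^j / j!` with
`T_{j,α} ∈ ℂ[[s]]`. -/
def IsExpansion (N : ℕ) (A : Finset ℚ) (ξ : ℚ → Polynomial ℂ) : Prop :=
  (∀ α, (ξ α).natDegree ≤ N) ∧ ∀ β, ξ β ≠ 0 → ∃ α ∈ A, ∃ k : ℕ, β = α + k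

theorem IsExpansion.add {N : ℕ} {A : Finset ℚ} {ξ η : ℚ → Polynomial ℂ} (h : IsExpansion N A ξ)
    (h' : IsExpansion N A η) : IsExpansion N A (ξ + η) := by
  refine ⟨fun α => (Polynomial.natDegree_add_le _ _).trans (max_le (h.1 α) (h'.1 α)),
    fun β hβ => ?_⟩
  by_cases h1 : ξ β = 0
  · exact h'.2 β fun h2 => hβ (by rw [Pi.add_apply, h1, h2, add_zero])
  · exact h.2 β h1

theorem IsExpansion.zero (N : ℕ) (A : Finset ℚ) : IsExpansion N A 0 :=
  ⟨fun _ => by simp, fun _ h => (h rfl).elim⟩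

theorem IsExpansion.smul {N : ℕ} {A : Finset ℚ} {ξ : ℚ → Polynomial ℂ} (c : ℂ)
    (h : IsExpansion N A ξ) : IsExpansion N A (c • ξ) :=
  ⟨fun α => (Polynomial.natDegree_smul_le _ _).trans (h.1 α),
    fun β hβ => h.2 β fun h1 => hβ (by rw [Pi.smul_apply, h1, smul_zero])⟩

theorem IsExpansion.mono {N N' : ℕ} {A A' : Finset ℚ} {ξ : ℚ → Polynomial ℂ}
    (h : IsExpansion N A ξ) (hN : N ≤ N') (hA : A ⊆ A') : IsExpansion N' A' ξ :=
  ⟨fun α => (h.1 α).trans hN, fun β hβ =>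
    let ⟨α, hα, k, hk⟩ := h.2 β hβ
    ⟨α, hA hα, k, hk⟩⟩

/-- The space of standard asymptotic expansions, as a space of families of polynomials. -/
def xiSubmodule : Submodule ℂ (ℚ → Polynomial ℂ) where
  carrier := {ξ | ∃ (N : ℕ) (A : Finset ℚ), (∀ α ∈ A, -1 < α) ∧ IsExpansion N A ξ}
  zero_mem' := ⟨0, ∅, by simp, IsExpansion.zero _ _⟩
  add_mem' := by
    classical
    rintro ξ η ⟨N, A, hA, h⟩ ⟨N', A', hA', h'⟩
    refine ⟨max N N', A ∪ A', fun α hα => ?_,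
      (h.mono (le_max_left _ _) Finset.subset_union_left).add
        (h'.mono (le_max_right _ _) Finset.subset_union_right)⟩
    rcases Finset.mem_union.1 hα with h | h
    exacts [hA α h, hA' α h]
  smul_mem' := fun c _ ⟨N, A, hA, h⟩ => ⟨N, A, hA, h.smul c⟩

/-- The space `Ξ` of standard asymptotic expansions. -/
def Xi : Type := xiSubmodule

namespace Xi

instance : AddCommGroup Xi := inferInstanceAs (AddCommGroup xiSubmodule)
instance : Module ℂ Xi := inferInstanceAs (Module ℂ xiSubmodule)

/-- The element of `Ξ` with given coefficients. -/
def mk (ξ : ℚ → Polynomial ℂ) (h : ξ ∈ xiSubmodule) : Xi := ⟨ξ, h⟩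

/-- The coefficient of `s^β` in an element of `Ξ`, a polynomial in `Log s`. -/
def coeff (β : ℚ) : Xi →ₗ[ℂ] Polynomial ℂ where
  toFun ξ := ξ.1 β
  map_add' _ _ := rfl
  map_smul' _ _ := rfl

theorem coeff_mk (ξ : ℚ → Polynomial ℂ) (h : ξ ∈ xiSubmodule) (β : ℚ) :
    coeff β (mk ξ h) = ξ β := rfl

theorem ext_coeff {ξ η : Xi} (h : ∀ β, coeff β ξ = coeff β η) : ξ = η :=
  Subtype.ext (funext h)

/-- A pair `(N, A)` as in the definition of a standard asymptotic expansion is valid for `ξ`. -/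
def HasType (N : ℕ) (A : Finset ℚ) (ξ : Xi) : Prop := IsExpansion N A fun β => coeff β ξ

theorem exists_hasType (ξ : Xi) :
    ∃ (N : ℕ) (A : Finset ℚ), (∀ α ∈ A, -1 < α) ∧ HasType N A ξ := ξ.2

theorem coeff_eq_zero (ξ : Xi) {β : ℚ} (hβ : β ≤ -1) : coeff β ξ = 0 := by
  obtain ⟨_, A, hA, hA'⟩ := ξ.exists_hasType
  by_contra h
  obtain ⟨α, hα, k, rfl⟩ := hA'.2 β h
  have h1 := hA α hα
  have h2 : (0 : ℚ) ≤ k := Nat.cast_nonneg k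
  linarith

theorem shift_isExpansion {N : ℕ} {A : Finset ℚ} {ξ : ℚ → Polynomial ℂ} (h : IsExpansion N A ξ)
    (f : ℚ → Polynomial ℂ → Polynomial ℂ) (hf : ∀ β p, (f β p).natDegree ≤ p.natDegree)
    (hf0 : ∀ β, f β 0 = 0) : IsExpansion N A fun β => f β (ξ (β - 1)) := by
  refine ⟨fun β => (hf _ _).trans (h.1 _), fun β hβ => ?_⟩
  obtain ⟨α, hα, k, hk⟩ := h.2 (β - 1) fun h0 => hβ (by simp only [h0, hf0])
  exact ⟨α, hα, k + 1, by push_cast; linarith⟩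

theorem opA_isExpansion {N : ℕ} {A : Finset ℚ} {ξ : Xi} (h : HasType N A ξ) :
    IsExpansion N A fun β => coeff (β - 1) ξ :=
  shift_isExpansion h (fun _ p => p) (fun _ _ => le_rfl) (fun _ => rfl)

theorem opB_isExpansion {N : ℕ} {A : Finset ℚ} {ξ : Xi} (h : HasType N A ξ) :
    IsExpansion N A fun β => logInv (β : ℂ) (coeff (β - 1) ξ) :=
  shift_isExpansion h (fun β p => logInv (β : ℂ) p) (fun _ _ => natDegree_logInv_le _ _)
    (fun _ => map_zero _)

theorem binvA_isExpansion {N : ℕ} {A : Finset ℚ} {ξ : Xi} (h : HasType N A ξ) :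
    IsExpansion N A fun β => ((β : ℂ) + 1) • coeff β ξ + Polynomial.derivative (coeff β ξ) := by
  refine ⟨fun β => ?_, fun β hβ => h.2 β fun h0 => hβ ?_⟩
  · refine (Polynomial.natDegree_add_le _ _).trans (max_le ?_ ?_)
    · exact (Polynomial.natDegree_smul_le _ _).trans (h.1 _)
    · exact (Polynomial.natDegree_derivative_le _).trans ((Nat.sub_le _ _).trans (h.1 _))
  · change coeff β ξ = 0 at h0
    simp only [h0, smul_zero, Polynomial.derivative_zero, add_zero]

theorem mem_of_hasType {ξ : Xi} {η : ℚ → Polynomial ℂ}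
    (h : ∀ N A, HasType N A ξ → IsExpansion N A η) : η ∈ xiSubmodule := by
  obtain ⟨N, A, hA, hA'⟩ := ξ.exists_hasType
  exact ⟨N, A, hA, h N A hA'⟩

/-- `a` is the multiplication by `s`. -/
def opA : Module.End ℂ Xi where
  toFun ξ := mk (fun β => coeff (β - 1) ξ) (mem_of_hasType fun _ _ => opA_isExpansion)
  map_add' _ _ := rfl
  map_smul' _ _ := rfl

/-- `b` is the primitive without constant: the primitive of `p(Log s) s^{β-1}` is
`q(Log s) s^β` with `β q + q' = p`. -/
def opB : Module.End ℂ Xi where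
  toFun ξ := mk (fun β => logInv (β : ℂ) (coeff (β - 1) ξ))
    (mem_of_hasType fun _ _ => opB_isExpansion)
  map_add' ξ η := by
    apply ext_coeff; intro β; simp only [coeff_mk, map_add]
  map_smul' c ξ := by
    apply ext_coeff; intro β; simp only [coeff_mk, map_smul, RingHom.id_apply]

/-- The operator `b⁻¹a` on `Ξ`, that is `ξ ↦ (d/ds)(s ξ)`. -/
def binvA : Module.End ℂ Xi where
  toFun ξ := mk (fun β => ((β : ℂ) + 1) • coeff β ξ + Polynomial.derivative (coeff β ξ))
    (mem_of_hasType fun _ _ => binvA_isExpansion)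
  map_add' ξ η := by
    apply ext_coeff; intro β
    simp only [coeff_mk, map_add, smul_add]
    abel
  map_smul' c ξ := by
    apply ext_coeff; intro β
    simp only [coeff_mk, map_smul, RingHom.id_apply, smul_add, smul_comm c]

theorem coeff_opA (ξ : Xi) (β : ℚ) : coeff β (opA ξ) = coeff (β - 1) ξ := rfl
theorem coeff_opB (ξ : Xi) (β : ℚ) :
    coeff β (opB ξ) = logInv (β : ℂ) (coeff (β - 1) ξ) := rfl
theorem coeff_binvA (ξ : Xi) (β : ℚ) :
    coeff β (binvA ξ) = ((β : ℂ) + 1) • coeff β ξ + Polynomial.derivative (coeff β ξ) := rfl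

theorem opB_injective : Function.Injective opB := by
  rw [injective_iff_map_eq_zero]
  intro ξ h
  apply ext_coeff
  intro β
  rw [map_zero]
  by_cases hβ : β ≤ -1
  · exact coeff_eq_zero ξ hβ
  · have h1 : logInv ((β + 1 : ℚ) : ℂ) (coeff β ξ) = 0 := by
      have := coeff_opB ξ (β + 1)
      rwa [h, map_zero, add_sub_cancel_right, eq_comm] at this
    have h2 : ((β + 1 : ℚ) : ℂ) ≠ 0 := by
      rw [Rat.cast_ne_zero]; intro h3; apply hβ; linarith
    rw [← add_derivative_logInv h2 (coeff β ξ), h1]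
    simp

/-- As `b` is injective on `Ξ`, this says that `binvA` is `b⁻¹a`. -/
theorem opB_binvA (ξ : Xi) : opB (binvA ξ) = opA ξ := by
  apply ext_coeff
  intro β
  rw [coeff_opB, coeff_binvA, coeff_opA]
  by_cases hβ : β = 0
  · rw [coeff_eq_zero ξ (β := β - 1) (by rw [hβ]; norm_num)]; simp
  · have h2 : ((β : ℚ) : ℂ) ≠ 0 := Rat.cast_ne_zero.2 hβ
    have h3 : (((β - 1 : ℚ) : ℂ) + 1) = (β : ℂ) := by push_cast; ring
    rw [h3, logInv_add_derivative h2]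

theorem opA_opB (ξ : Xi) : opA (opB ξ) = opB (opA ξ) + opB (opB ξ) := by
  apply ext_coeff
  intro β
  rw [map_add]
  simp only [coeff_opA, coeff_opB]
  by_cases h : β ≤ 1
  · rw [coeff_eq_zero ξ (β := β - 1 - 1) (by linarith)]; simp
  · have h0 : ((β : ℚ) : ℂ) ≠ 0 := Rat.cast_ne_zero.2 (by intro h'; apply h; linarith)
    have h1 : ((β : ℚ) : ℂ) - 1 ≠ 0 := by
      have : ((β - 1 : ℚ) : ℂ) ≠ 0 := Rat.cast_ne_zero.2 (by intro h'; apply h; linarith)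
      rwa [Rat.cast_sub, Rat.cast_one] at this
    rw [Rat.cast_sub, Rat.cast_one]
    exact logInv_sub h0 h1 _

theorem coeff_opB_pow_eq_zero (ξ : Xi) (n : ℕ) {β : ℚ} (hβ : β - n ≤ -1) :
    coeff β ((opB ^ n) ξ) = 0 := by
  induction n generalizing β with
  | zero => exact coeff_eq_zero ξ (by simpa using hβ)
  | succ n ih =>
    rw [pow_succ', Module.End.mul_apply, coeff_opB, ih, map_zero]
    push_cast at hβ
    linarith

theorem coeff_partialSum (F : ℕ → Polynomial ℂ) (ξ : Xi) {β : ℚ} {N N' : ℕ} (hN : β - N ≤ -1)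
    (h : N ≤ N') :
    coeff β (partialSum opA opB F ξ N) = coeff β (partialSum opA opB F ξ N') := by
  induction N', h using Nat.le_induction with
  | base => rfl
  | succ N' hN' ih =>
    rw [partialSum_succ, ih, map_add, coeff_opB_pow_eq_zero, add_zero]
    have : (N : ℚ) ≤ N' := by exact_mod_cast hN'
    linarith

/-- An integer `N` such that the terms of index at least `N` of a sum `∑ₙ bⁿ ξₙ` do not
contribute to the coefficient of `s^β`. -/
def bound (β : ℚ) : ℕ := ⌈β⌉₊ + 1

theorem sub_bound_le (β : ℚ) : β - bound β ≤ -1 := by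
  have := Nat.le_ceil β
  rw [bound]; push_cast; linarith

/-- The elements of `Ξ` of given type form a subspace. -/
def typeSubmodule (N : ℕ) (A : Finset ℚ) : Submodule ℂ Xi where
  carrier := {ξ | HasType N A ξ}
  zero_mem' := IsExpansion.zero N A
  add_mem' h h' := IsExpansion.add h h'
  smul_mem' c _ h := IsExpansion.smul c h

theorem hasType_opB_pow {N : ℕ} {A : Finset ℚ} {ξ : Xi} (h : HasType N A ξ) (n : ℕ) :
    HasType N A ((opB ^ n) ξ) := by
  induction n with
  | zero => exact h
  | succ n ih => rw [pow_succ', Module.End.mul_apply]; exact opB_isExpansion ih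

theorem hasType_aeval {N : ℕ} {A : Finset ℚ} {ξ : Xi} (h : HasType N A ξ) (p : Polynomial ℂ) :
    HasType N A (Polynomial.aeval opA p ξ) := by
  induction p using Polynomial.induction_on with
  | C c =>
    rw [Polynomial.aeval_C, Module.algebraMap_end_apply]
    exact (typeSubmodule N A).smul_mem c h
  | add p q hp hq =>
    rw [map_add, LinearMap.add_apply]
    exact (typeSubmodule N A).add_mem hp hq
  | monomial n c ih =>
    rw [pow_succ', mul_left_comm, map_mul, Module.End.mul_apply, Polynomial.aeval_X]
    exact opA_isExpansion ih

theorem hasType_partialSum {N : ℕ} {A : Finset ℚ} {ξ : Xi} (h : HasType N A ξ)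
    (F : ℕ → Polynomial ℂ) (M : ℕ) : HasType N A (partialSum opA opB F ξ M) :=
  (typeSubmodule N A).sum_mem fun i _ => hasType_opB_pow (hasType_aeval h (F i)) i

/-- `F · ξ = ∑ₙ bⁿ Fₙ(a) ξ` for `F = ∑ₙ bⁿ Fₙ(a)` in `Ã`; in the coefficient of `s^β` only
finitely many terms are nonzero. -/
def act (F : ATilde) (ξ : Xi) : Xi :=
  mk (fun β => coeff β (partialSum opA opB F.coeff ξ (bound β))) (mem_of_hasType fun _ _ h =>
    ⟨fun β => (hasType_partialSum h F.coeff (bound β)).1 β,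
      fun β => (hasType_partialSum h F.coeff (bound β)).2 β⟩)

theorem coeff_act (F : ATilde) (ξ : Xi) {β : ℚ} {N : ℕ} (h : bound β ≤ N) :
    coeff β (act F ξ) = coeff β (partialSum opA opB F.coeff ξ N) :=
  coeff_partialSum _ _ (sub_bound_le β) h

theorem bound_sub_one (β : ℚ) : bound (β - 1) ≤ bound β := by
  unfold bound
  exact Nat.add_le_add_right (Nat.ceil_le_ceil (by linarith)) 1

theorem act_opB (F : ATilde) (ξ : Xi) : act (ATilde.opB F) ξ = opB (act F ξ) := by
  apply ext_coeff
  intro β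
  rw [coeff_act _ _ (Nat.le_succ (bound β)), partialSum_opB, coeff_opB, coeff_opB,
    coeff_act F ξ (bound_sub_one β)]

theorem act_opA (F : ATilde) (ξ : Xi) : act (ATilde.opA F) ξ = opA (act F ξ) := by
  apply ext_coeff
  intro β
  rw [coeff_act _ _ (Nat.le_succ (bound β)), partialSum_opA _ _ opA_opB, map_add,
    coeff_opB_pow_eq_zero _ _ (sub_bound_le β), add_zero, coeff_opA, coeff_opA,
    coeff_act F ξ (bound_sub_one β)]

theorem one_act (ξ : Xi) : act 1 ξ = ξ := by
  apply ext_coeff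
  intro β
  rw [coeff_act _ _ (Nat.le_succ (bound β)), partialSum_one]

theorem act_add (F : ATilde) (ξ η : Xi) : act F (ξ + η) = act F ξ + act F η := by
  apply ext_coeff
  intro β
  simp only [map_add, coeff_act _ _ le_rfl, partialSum_add_right]

theorem act_zero (F : ATilde) : act F 0 = 0 := by
  apply ext_coeff
  intro β
  rw [coeff_act _ _ le_rfl, partialSum_zero_right]

/-- The map `F ↦ F · ξ` as a linear map. -/
def actLeft (ξ : Xi) : ATilde →ₗ[ℂ] Xi where
  toFun F := act F ξ
  map_add' F G := by
    apply ext_coeff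
    intro β
    simp only [map_add, coeff_act _ _ le_rfl, partialSum_add]
  map_smul' c F := by
    apply ext_coeff
    intro β
    simp only [map_smul, coeff_act _ _ le_rfl, partialSum_smul, RingHom.id_apply]

theorem opB_sep (ξ : Xi) (h : ∀ N : ℕ, ∃ η, ξ = (opB ^ N) η) : ξ = 0 := by
  apply ext_coeff
  intro β
  obtain ⟨η, hη⟩ := h (bound β)
  rw [hη, coeff_opB_pow_eq_zero _ _ (sub_bound_le β), map_zero]

theorem mul_act (F G : ATilde) (ξ : Xi) : act (F * G) ξ = act F (act G ξ) := by
  have : (actLeft ξ).comp (ATilde.mulRight G) = actLeft (act G ξ) := by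
    refine intertwiner_ext opB_sep (a := opA) (b := opB) ?_ ?_ (fun F => act_opA F _)
      (fun F => act_opB F _) ?_
    · intro F
      change act (ATilde.opA F * G) ξ = opA (act (F * G) ξ)
      rw [ATilde.opA_mul, act_opA]
    · intro F
      change act (ATilde.opB F * G) ξ = opB (act (F * G) ξ)
      rw [ATilde.opB_mul, act_opB]
    · change act (1 * G) ξ = act 1 (act G ξ)
      rw [one_mul, one_act]
  exact LinearMap.congr_fun this F

/-- `Ξ` as a left `Ã`-module. -/
instance : Module ATilde Xi where
  smul := act
  one_smul := one_act
  mul_smul := mul_act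
  smul_zero := act_zero
  smul_add := act_add
  add_smul F G ξ := (actLeft ξ).map_add F G
  zero_smul ξ := (actLeft ξ).map_zero

theorem smul_def (F : ATilde) (ξ : Xi) : F • ξ = act F ξ := rfl

theorem a_smul (ξ : Xi) : ATilde.a • ξ = opA ξ := by
  rw [smul_def, ← ATilde.opA_one, act_opA, one_act]

theorem b_smul (ξ : Xi) : ATilde.b • ξ = opB ξ := by
  rw [smul_def, ATilde.b, act_opB, one_act]

/-- `Ξ` as a module over `ℂ[[b]] ⊆ Ã`. -/
instance : Module (PowerSeries ℂ) Xi := Module.compHom Xi ATilde.ofPowerSeries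

theorem powerSeries_smul_def (S : PowerSeries ℂ) (ξ : Xi) :
    S • ξ = ATilde.ofPowerSeries S • ξ := rfl

instance : IsScalarTower (PowerSeries ℂ) ATilde Xi := ⟨fun _ F ξ => mul_act _ F ξ⟩

instance : IsScalarTower ℂ (PowerSeries ℂ) Xi := ⟨fun c _ ξ => by
  rw [powerSeries_smul_def, powerSeries_smul_def, ATilde.ofPowerSeries_smul]
  exact (actLeft ξ).map_smul c _⟩

theorem X_smul (ξ : Xi) : (PowerSeries.X : PowerSeries ℂ) • ξ = opB ξ := by
  rw [powerSeries_smul_def, ATilde.ofPowerSeries_X, b_smul]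

theorem binvA_opB (ξ : Xi) : binvA (opB ξ) = opB (binvA ξ + ξ) := by
  apply opB_injective
  rw [opB_binvA, map_add, map_add, opB_binvA, opA_opB]

end Xi

/-- The set `ℚ ∩ ]-1, +∞[` of exponents. -/
abbrev Exponent : Type := {α : ℚ // -1 < α}

/-- The monomial `e_{α,j} = s^α (Log s)^j / j!`. -/
def logMonomial (α : Exponent) (j : ℕ) : Xi :=
  Xi.mk (fun β => if β = α.1 then Polynomial.monomial j ((Nat.factorial j : ℂ)⁻¹) else 0) <| by
    refine ⟨j, {α.1}, fun β hβ => ?_, fun β => ?_, fun β hβ => ⟨α.1, by simp, 0, ?_⟩⟩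
    · rw [Finset.mem_singleton.1 hβ]; exact α.2
    · dsimp only
      split_ifs
      · exact Polynomial.natDegree_monomial_le _
      · simp
    · by_contra h
      exact hβ (if_neg (by simpa using h))

theorem coeff_logMonomial (α : Exponent) (j : ℕ) (β : ℚ) : Xi.coeff β (logMonomial α j) =
    if β = α.1 then Polynomial.monomial j ((Nat.factorial j : ℂ)⁻¹) else 0 := rfl

/-- The exponent `α + 1`. -/
def Exponent.succ (α : Exponent) : Exponent := ⟨α.1 + 1, by linarith [α.2]⟩

theorem Exponent.add_one_ne_zero (α : Exponent) : (α.1 : ℂ) + 1 ≠ 0 := by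
  have : ((α.1 + 1 : ℚ) : ℂ) ≠ 0 := Rat.cast_ne_zero.2 (by linarith [α.2])
  rwa [Rat.cast_add, Rat.cast_one] at this

theorem a_logMonomial (α : Exponent) (j : ℕ) :
    ATilde.a • logMonomial α j = logMonomial α.succ j := by
  rw [Xi.a_smul]
  apply Xi.ext_coeff
  intro β
  simp only [Xi.coeff_opA, coeff_logMonomial, Exponent.succ, sub_eq_iff_eq_add]

theorem binvA_logMonomial_zero (α : Exponent) :
    Xi.binvA (logMonomial α 0) = ((α.1 : ℂ) + 1) • logMonomial α 0 := by
  apply Xi.ext_coeff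
  intro β
  rw [Xi.coeff_binvA, map_smul, coeff_logMonomial]
  split_ifs with h
  · rw [h]; simp
  · simp

theorem binvA_logMonomial_succ (α : Exponent) (j : ℕ) :
    Xi.binvA (logMonomial α (j + 1)) =
      ((α.1 : ℂ) + 1) • logMonomial α (j + 1) + logMonomial α j := by
  apply Xi.ext_coeff
  intro β
  rw [Xi.coeff_binvA, map_add, map_smul, coeff_logMonomial, coeff_logMonomial]
  split_ifs with h
  · have hj : ((j : ℂ) + 1) ≠ 0 := Nat.cast_add_one_ne_zero j
    have : ((Nat.factorial (j + 1) : ℂ)⁻¹ * ((j : ℂ) + 1)) = (Nat.factorial j : ℂ)⁻¹ := by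
      rw [Nat.factorial_succ]; push_cast; field_simp
    rw [h, Polynomial.derivative_monomial, Nat.cast_add, Nat.cast_one, this, Nat.add_sub_cancel]
  · simp

theorem b_logMonomial_zero (α : Exponent) :
    ATilde.b • logMonomial α 0 = (1 / ((α.1 : ℂ) + 1)) • logMonomial α.succ 0 := by
  have key := Xi.opB_binvA (logMonomial α 0)
  rw [binvA_logMonomial_zero, map_smul, ← Xi.a_smul, a_logMonomial, ← Xi.b_smul] at key
  rw [← key, smul_smul, one_div, inv_mul_cancel₀ α.add_one_ne_zero, one_smul]

theorem b_logMonomial_succ (α : Exponent) (j : ℕ) :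
    ATilde.b • logMonomial α (j + 1) = (1 / ((α.1 : ℂ) + 1)) • logMonomial α.succ (j + 1) -
      (1 / ((α.1 : ℂ) + 1)) • (ATilde.b • logMonomial α j) := by
  have key := Xi.opB_binvA (logMonomial α (j + 1))
  rw [binvA_logMonomial_succ, map_add, map_smul, ← Xi.a_smul, a_logMonomial, ← Xi.b_smul,
    ← Xi.b_smul] at key
  rw [← key, smul_add, smul_smul, one_div, inv_mul_cancel₀ α.add_one_ne_zero, one_smul,
    add_sub_cancel_right]

/-! ## Canonical form -/

/-- `φ = ∑_{(α,j) ∈ A} S_{α,j}(b) s^α (Log s)^j / j!` is the canonical form of `φ`. The values of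
`S` outside `A` play no role. -/
structure IsCanonicalForm (φ : Xi) (A : Finset (Exponent × ℕ))
    (S : Exponent × ℕ → PowerSeries ℂ) : Prop where
  eq_sum : φ = ∑ p ∈ A, S p • logMonomial p.1 p.2
  saturated : ∀ α j, (α, j) ∈ A → ∀ i ≤ j, (α, i) ∈ A
  zero_or_unit : ∀ α j, (α, j) ∈ A →
    S (α, j) = 0 ∨ PowerSeries.constantCoeff (S (α, j)) ≠ 0
  exists_unit : ∀ α j, (α, j) ∈ A →
    ∃ k ≥ j, (α, k) ∈ A ∧ PowerSeries.constantCoeff (S (α, k)) ≠ 0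
  translate_zero : ∀ (α β : Exponent) (j p : ℕ), (α, j) ∈ A → S (α, j) ≠ 0 →
    0 < p → β.1 = α.1 + p → (β, j) ∈ A → S (β, j) = 0

/-- The group `ℚ / ℤ`. -/
abbrev QModZ : Type := ℚ ⧸ AddSubgroup.zmultiples (1 : ℚ)

/-- The class modulo `ℤ` of a rational number. -/
def classOf (α : ℚ) : QModZ := QuotientAddGroup.mk α

open Classical in
/-- The finite set of the classes modulo `ℤ` of the exponents `α` with `(α, j) ∈ A`. -/
def classes (A : Finset (Exponent × ℕ)) : Finset QModZ := A.image fun p => classOf p.1.1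

/-- `n(Λ)`, the largest `j` such that `S_{α,j}(0) ≠ 0` for some `(α, j) ∈ A` with `α ∈ Λ`. -/
def maxLog (A : Finset (Exponent × ℕ)) (S : Exponent × ℕ → PowerSeries ℂ) (Λ : QModZ) : ℕ :=
  sSup {j : ℕ | ∃ α : Exponent, (α, j) ∈ A ∧ classOf α.1 = Λ ∧
    PowerSeries.constantCoeff (S (α, j)) ≠ 0}

/-- `Λ⁺`, the largest `α ∈ Λ` such that `(α, n(Λ)) ∈ A` and `S_{α,n(Λ)}(0) ≠ 0`. -/
def topExponent (A : Finset (Exponent × ℕ)) (S : Exponent × ℕ → PowerSeries ℂ) (Λ : QModZ) : ℝ :=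
  sSup {x : ℝ | ∃ α : Exponent, x = (α.1 : ℝ) ∧ classOf α.1 = Λ ∧ (α, maxLog A S Λ) ∈ A ∧
    PowerSeries.constantCoeff (S (α, maxLog A S Λ)) ≠ 0}

/-! ## The `(a,b)`-module generated by an element and its Bernstein polynomial -/

/-- The left `Ã`-module `Ã φ ⊆ Ξ`. -/
def cyclic (φ : Xi) : Submodule ATilde Xi := Submodule.span ATilde {φ}

/-- The saturation `E♯` of `E` by `b⁻¹a`: the smallest `ℂ[[b]]`-submodule containing `E` and
stable by `b⁻¹a`.  As `b` is injective on `Ξ` and `Ξ` is stable by `b⁻¹a`, the saturation in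
`E[b⁻¹] ⊆ Ξ[b⁻¹]` is contained in `Ξ`. -/
def saturation (E : Submodule ATilde Xi) : Submodule (PowerSeries ℂ) Xi :=
  sInf {F | (E : Set Xi) ⊆ F ∧ ∀ ξ ∈ F, Xi.binvA ξ ∈ F}

theorem binvA_mem_saturation (E : Submodule ATilde Xi) {ξ : Xi} (h : ξ ∈ saturation E) :
    Xi.binvA ξ ∈ saturation E := by
  simp only [saturation, Submodule.mem_sInf] at h ⊢
  exact fun F hF => hF.2 ξ (h F hF)

/-- `E♯` as a complex vector space. -/
abbrev satC (E : Submodule ATilde Xi) : Submodule ℂ Xi := (saturation E).restrictScalars ℂ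

/-- The operator `b⁻¹a` of `E♯`. -/
def satBinvA (E : Submodule ATilde Xi) : Module.End ℂ (satC E) :=
  Xi.binvA.restrict fun _ h => binvA_mem_saturation E h

/-- The operator `b` of `E♯`. -/
def satB (E : Submodule ATilde Xi) : Module.End ℂ (satC E) :=
  Xi.opB.restrict fun ξ h => by
    rw [← Xi.X_smul]
    exact (saturation E).smul_mem _ h

/-- The complex vector space `E♯ / b E♯`. -/
abbrev satQuot (E : Submodule ATilde Xi) : Type := satC E ⧸ LinearMap.range (satB E)

/-- The endomorphism of `E♯ / b E♯` induced by `b⁻¹a`. -/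
def residue (E : Submodule ATilde Xi) : Module.End ℂ (satQuot E) :=
  Submodule.mapQ _ _ (satBinvA E) <| by
    rintro _ ⟨ξ, rfl⟩
    refine ⟨satBinvA E ξ + ξ, Subtype.ext ?_⟩
    exact (Xi.binvA_opB ξ.1).symm

/-- An `(a,b)`-module is a left `Ã`-module which is free of finite type over `ℂ[[b]]`. -/
def IsABModule (E : Submodule ATilde Xi) : Prop :=
  Module.Free (PowerSeries ℂ) E ∧ Module.Finite (PowerSeries ℂ) E

/-- `E` is regular when `E♯` is of finite type over `ℂ[[b]]`. -/
def IsRegular (E : Submodule ATilde Xi) : Prop := Module.Finite (PowerSeries ℂ) (saturation E)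

/-- The rank of an `(a,b)`-module. -/
def rank (E : Submodule ATilde Xi) : ℕ := Module.finrank (PowerSeries ℂ) E

open Classical in
/-- The Bernstein polynomial of `E`: the characteristic polynomial of `-b⁻¹a` acting on
`E♯ / b E♯`, which is finite dimensional when `E` is regular. -/
def bernstein (E : Submodule ATilde Xi) : Polynomial ℂ :=
  if h : Module.Finite ℂ (satQuot E) then
    haveI := h
    (-residue E).charpoly
  else 0

open Classical in
/-- The number, counted with multiplicity, of the roots of `P` which are rational numbers in the
class `Λ`. -/
def rootsCount (P : Polynomial ℂ) (Λ : QModZ) : ℕ :=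
  P.roots.countP fun r => ∃ q : ℚ, r = (q : ℂ) ∧ classOf q = Λ

end ABMod

end

noncomputable section

namespace ABMod

/-! ## Submodules of `Ξ` cut out by bounds on the degrees in `Log s` -/

/-! Let `d β` be the maximum of `j + 1` over the terms `(α, j)` of the canonical form with `S (α, j)
≠ 0` and `β ∈ α + ℕ` (zero if there are none), and let `L` be the space of series whose coefficient
of `s^β` has degree less than `d β` in `Log s`. The whole proof rests on the equality `E♯ = L`.

Along each class mod `ℤ` the function `d` is nondecreasing, so `L` is an `Ã`-submodule, and it is
stable by `b⁻¹a`. Since `b` raises exponents by one, `bL` consists of the series of `L` bounded by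
`d (β - 1)`. Hence `L / bL` has as basis the classes of the `s^β (Log s)^j / j!` with `d (β - 1) ≤ j
< d β`; call `I` this finite index set. By `b`-adic expansion the same monomials form a
`ℂ[[b]]`-basis of `L`. On `L / bL`, which `symbol` identifies with `ℂ^I`, `b⁻¹a` has a single Jordan
block for each exponent `α` occurring in `I`, with eigenvalue `α + 1`.

The inclusion `E♯ ⊆ L` is clear. Conversely, conditions (i) and (ii) show that the symbol of `φ` is
nonzero at the top of every block (`coeff_ne_zero`). The eigenvalues of the blocks being distinct,
this symbol is a cyclic vector (`eq_top_of_symbolOp_mem`), so `E♯` maps onto `L / bL`, and Nakayama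
gives `E♯ = L` (`saturation_eq`).

Then `E` is free as a submodule of a free module over a principal ring. Its rank is the cardinality
of `I`, because some `b^N` sends `E♯` into `E`. Finally `B_E` is the product of the `X + α + 1` over
`(α, j) ∈ I`. On a class `Λ`, `d` climbs from `0` to `n(Λ) + 1`, so each `j ≤ n(Λ)` is crossed
exactly once (`card_filter_profileIndex`). By (iv), `j = n(Λ)` is crossed at `Λ⁺`
(`top_mem_profileIndex`). -/

theorem logInv_mem_degreeLT (β : ℂ) {p : Polynomial ℂ} {n : ℕ}
    (hp : p ∈ Polynomial.degreeLT ℂ n) : logInv β p ∈ Polynomial.degreeLT ℂ n := by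
  rcases eq_or_ne p 0 with rfl | h
  · rw [map_zero]; exact zero_mem _
  · rw [Polynomial.mem_degreeLT] at hp ⊢
    refine Polynomial.degree_le_natDegree.trans_lt ?_
    have := (Polynomial.natDegree_lt_iff_degree_lt h).2 hp
    exact_mod_cast (natDegree_logInv_le β p).trans_lt this

theorem derivative_mem_degreeLT {p : Polynomial ℂ} {n : ℕ}
    (hp : p ∈ Polynomial.degreeLT ℂ n) : Polynomial.derivative p ∈ Polynomial.degreeLT ℂ n := by
  rw [Polynomial.mem_degreeLT] at hp ⊢
  exact Polynomial.degree_derivative_le.trans_lt hp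

theorem coeff_eq_zero_of_mem_degreeLT {p : Polynomial ℂ} {n j : ℕ}
    (hp : p ∈ Polynomial.degreeLT ℂ n) (h : n ≤ j) : p.coeff j = 0 :=
  Polynomial.coeff_eq_zero_of_degree_lt
    ((Polynomial.mem_degreeLT.1 hp).trans_le (by exact_mod_cast h))

theorem mem_degreeLT_of_coeff {p : Polynomial ℂ} {n : ℕ} (h : ∀ j, n ≤ j → p.coeff j = 0) :
    p ∈ Polynomial.degreeLT ℂ n :=
  Polynomial.mem_degreeLT.2 ((Polynomial.degree_lt_iff_coeff_zero p n).2 h)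

theorem degreeLT_le {m n : ℕ} (h : m ≤ n) :
    Polynomial.degreeLT ℂ m ≤ Polynomial.degreeLT ℂ n := Polynomial.degreeLT_mono h

/-- The `ℂ`-subspace of the series whose coefficient of `s^β` has degree less than `d β`. -/
def logBoundedC (d : ℚ → ℕ) : Submodule ℂ Xi where
  carrier := {ξ | ∀ β, Xi.coeff β ξ ∈ Polynomial.degreeLT ℂ (d β)}
  zero_mem' β := by rw [map_zero]; exact zero_mem _
  add_mem' h h' β := by rw [map_add]; exact add_mem (h β) (h' β)
  smul_mem' c ξ h β := by rw [map_smul]; exact Submodule.smul_mem _ c (h β)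

section Mono

variable {d : ℚ → ℕ} (hd : ∀ β, d (β - 1) ≤ d β)

include hd

theorem opA_mem_logBoundedC {ξ : Xi} (h : ξ ∈ logBoundedC d) : Xi.opA ξ ∈ logBoundedC d :=
  fun β => degreeLT_le (hd β) (h (β - 1))

theorem opB_mem_logBoundedC {ξ : Xi} (h : ξ ∈ logBoundedC d) : Xi.opB ξ ∈ logBoundedC d :=
  fun β => degreeLT_le (hd β) (logInv_mem_degreeLT _ (h (β - 1)))

/-- Each coefficient of `F · ξ` is a coefficient of a finite sum of `bⁱ Fᵢ(a) ξ`, so stability by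
`a` and `b` suffices and no limit is involved. -/
theorem act_mem_logBoundedC {ξ : Xi} (h : ξ ∈ logBoundedC d) (F : ATilde) :
    Xi.act F ξ ∈ logBoundedC d := by
  intro β
  rw [Xi.coeff_act F ξ le_rfl]
  refine (?_ : partialSum Xi.opA Xi.opB F.coeff ξ _ ∈ logBoundedC d) β
  refine Submodule.sum_mem _ fun i _ => ?_
  have hB : ∀ (n : ℕ) (η : Xi), η ∈ logBoundedC d → (Xi.opB ^ n) η ∈ logBoundedC d := by
    intro n
    induction n with
    | zero => exact fun η hη => hη
    | succ n ih =>
      intro η hη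
      rw [pow_succ', Module.End.mul_apply]
      exact opB_mem_logBoundedC hd (ih η hη)
  refine hB i _ ?_
  induction F.coeff i using Polynomial.induction_on with
  | C c =>
    rw [Polynomial.aeval_C, Module.algebraMap_end_apply]
    exact Submodule.smul_mem _ c h
  | add p q hp hq =>
    rw [map_add, LinearMap.add_apply]
    exact add_mem hp hq
  | monomial n c ih =>
    rw [pow_succ', mul_left_comm, map_mul, Module.End.mul_apply, Polynomial.aeval_X]
    exact opA_mem_logBoundedC hd ih

end Mono

theorem binvA_mem_logBoundedC {d : ℚ → ℕ} {ξ : Xi} (h : ξ ∈ logBoundedC d) :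
    Xi.binvA ξ ∈ logBoundedC d := fun β => by
  rw [Xi.coeff_binvA]
  exact add_mem (Submodule.smul_mem _ _ (h β)) (derivative_mem_degreeLT (h β))

/-- The `Ã`-submodule of the series whose coefficient of `s^β` has degree less than `d β`. -/
def logBounded (d : ℚ → ℕ) (hd : ∀ β, d (β - 1) ≤ d β) : Submodule ATilde Xi :=
  { logBoundedC d with smul_mem' := fun F _ h => act_mem_logBoundedC hd h F }

theorem mem_logBounded {d : ℚ → ℕ} {hd : ∀ β, d (β - 1) ≤ d β} {ξ : Xi} :
    ξ ∈ logBounded d hd ↔ ∀ β, Xi.coeff β ξ ∈ Polynomial.degreeLT ℂ (d β) := Iff.rfl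

theorem powerSeries_smul_mem (E : Submodule ATilde Xi) (T : PowerSeries ℂ) {ξ : Xi} (h : ξ ∈ E) :
    T • ξ ∈ E := E.smul_mem (ATilde.ofPowerSeries T) h

theorem C_smul (c : ℂ) (ξ : Xi) : (PowerSeries.C c : PowerSeries ℂ) • ξ = c • ξ := by
  rw [← mul_one (PowerSeries.C c : PowerSeries ℂ), ← PowerSeries.smul_eq_C_mul, smul_assoc,
    one_smul]

/-- `T - T(0)` is divisible by `X`, which acts as `b`. This is how `ℂ[[b]]` is reduced modulo `b`,
with `T'` independent of `ξ`. -/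
theorem exists_powerSeries_smul_eq (T : PowerSeries ℂ) : ∃ T' : PowerSeries ℂ,
    ∀ ξ : Xi, T • ξ = PowerSeries.constantCoeff T • ξ + Xi.opB (T' • ξ) := by
  obtain ⟨T', hT'⟩ : (PowerSeries.X : PowerSeries ℂ) ∣ T - PowerSeries.C (T.constantCoeff) :=
    PowerSeries.X_dvd_iff.2 (by simp)
  refine ⟨T', fun ξ => ?_⟩
  rw [← Xi.X_smul, smul_smul, ← hT', sub_smul, C_smul, add_sub_cancel]

/-- The preimage is the derivative `dξ/ds`. The absence of exponents `≤ 0` keeps its exponents in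
`]-1, +∞[` and ensures that no constant term is lost. -/
theorem exists_opB_eq {ξ : Xi} (h : ∀ β ≤ 0, Xi.coeff β ξ = 0) : ∃ η : Xi, Xi.opB η = ξ ∧
    ∀ β, Xi.coeff β η = ((β : ℂ) + 1) • Xi.coeff (β + 1) ξ +
      Polynomial.derivative (Xi.coeff (β + 1) ξ) := by
  classical
  have hmem : (fun β : ℚ => ((β : ℂ) + 1) • Xi.coeff (β + 1) ξ +
      Polynomial.derivative (Xi.coeff (β + 1) ξ)) ∈ xiSubmodule := by
    obtain ⟨N, A, hA, hN, hA'⟩ := ξ.exists_hasType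
    -- A generator `α > 0` becomes `α - 1 > -1`. A generator `α ≤ 0` can be kept: the coefficient at
    -- `α` itself vanishes, so the exponents that occur start at `α + 1` and are moved into `α + ℕ`.
    refine ⟨N, A ∪ (A.filter (0 < ·)).image (· - 1), fun α hα => ?_, fun β => ?_, fun β hβ => ?_⟩
    · simp only [Finset.mem_union, Finset.mem_image, Finset.mem_filter] at hα
      obtain hα | ⟨γ, ⟨_, hγ⟩, rfl⟩ := hα
      · exact hA α hα
      · linarith
    · refine (Polynomial.natDegree_add_le _ _).trans (max_le ?_ ?_)
      · exact (Polynomial.natDegree_smul_le _ _).trans (hN _)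
      · exact (Polynomial.natDegree_derivative_le _).trans ((Nat.sub_le _ _).trans (hN _))
    · have h0 : Xi.coeff (β + 1) ξ ≠ 0 := fun h0 => hβ (by simp [h0])
      have h1 : 0 < β + 1 := not_le.1 fun h1 => h0 (h _ h1)
      obtain ⟨α, hα, k, hk⟩ := hA' _ h0
      rcases lt_or_ge 0 α with h2 | h2
      · refine ⟨α - 1, ?_, k, by linarith⟩
        simp only [Finset.mem_union, Finset.mem_image, Finset.mem_filter]
        exact Or.inr ⟨α, ⟨hα, h2⟩, rfl⟩
      · cases k with
        | zero => rw [hk] at h1; simp at h1; linarith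
        | succ k => exact ⟨α, Finset.mem_union_left _ hα, k, by push_cast at hk; linarith⟩
  refine ⟨Xi.mk _ hmem, Xi.ext_coeff fun β => ?_, fun β => rfl⟩
  rw [Xi.coeff_opB, Xi.coeff_mk, sub_add_cancel]
  rcases eq_or_ne β 0 with rfl | h0
  · rw [h 0 le_rfl]; simp
  · rw [Rat.cast_sub, Rat.cast_one, sub_add_cancel,
      logInv_add_derivative (Rat.cast_ne_zero.2 h0)]

/-! ## The basis of a submodule given by degree bounds -/

/-- `I` is the finite set of the `(β, j)` with `d (β - 1) ≤ j < d β`, where `d` is a bound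
which increases along the translates of an exponent. -/
structure IsProfile (d : ℚ → ℕ) (I : Finset (Exponent × ℕ)) : Prop where
  mono : ∀ β, d (β - 1) ≤ d β
  eq_zero : ∀ β ≤ -1, d β = 0
  mem_iff : ∀ α j, (α, j) ∈ I ↔ d (α.1 - 1) ≤ j ∧ j < d α.1

/-- The coefficients of the `s^β (Log s)^j / j!` for `(β, j) ∈ I`. -/
def symbol (I : Finset (Exponent × ℕ)) : Xi →ₗ[ℂ] (I → ℂ) :=
  LinearMap.pi fun p => (Nat.factorial p.1.2 : ℂ) •
    (Polynomial.lcoeff ℂ p.1.2).comp (Xi.coeff p.1.1.1)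

theorem symbol_apply (I : Finset (Exponent × ℕ)) (ξ : Xi) (p : I) :
    symbol I ξ p = (Nat.factorial p.1.2 : ℂ) * (Xi.coeff p.1.1.1 ξ).coeff p.1.2 := rfl

/-- The operator induced by `b⁻¹a` on the symbols. -/
def symbolOp (I : Finset (Exponent × ℕ)) : Module.End ℂ (I → ℂ) := by
  classical
  exact LinearMap.pi fun p => ((p.1.1.1 : ℂ) + 1) • LinearMap.proj p +
    if h : (p.1.1, p.1.2 + 1) ∈ I then LinearMap.proj ⟨_, h⟩ else 0

theorem symbol_logMonomial [DecidableEq (Exponent × ℕ)] (I : Finset (Exponent × ℕ)) (q : I) :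
    symbol I (logMonomial q.1.1 q.1.2) = Pi.single q 1 := by
  ext p
  rw [symbol_apply, coeff_logMonomial]
  obtain ⟨⟨α, j⟩, hp⟩ := p
  obtain ⟨⟨β, k⟩, hq⟩ := q
  dsimp only
  by_cases h : α = β
  · subst h
    rw [if_pos rfl, Polynomial.coeff_monomial]
    by_cases h' : k = j
    · subst h'
      have : (Nat.factorial k : ℂ) ≠ 0 := Nat.cast_ne_zero.2 (Nat.factorial_ne_zero k)
      simp [this]
    · rw [if_neg h', mul_zero, Pi.single_eq_of_ne]
      rintro h; simp at h; exact h' h.symm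
  · rw [if_neg (fun h' => h (Subtype.ext h')), Polynomial.coeff_zero, mul_zero,
      Pi.single_eq_of_ne]
    rintro h'; simp at h'; exact h h'.1

theorem symbol_sum (I : Finset (Exponent × ℕ)) (c : I → ℂ) :
    symbol I (∑ p, c p • logMonomial p.1.1 p.1.2) = c := by
  classical
  rw [map_sum]
  simp only [map_smul, symbol_logMonomial]
  exact (pi_eq_sum_univ' c).symm

namespace IsProfile

variable {d : ℚ → ℕ} {I : Finset (Exponent × ℕ)} (hI : IsProfile d I)

include hI

theorem logMonomial_mem {p : Exponent × ℕ} (hp : p ∈ I) :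
    logMonomial p.1 p.2 ∈ logBounded d hI.mono := by
  rw [mem_logBounded]
  intro β
  rw [coeff_logMonomial]
  split_ifs with h
  · subst h
    rw [Polynomial.mem_degreeLT]
    exact (Polynomial.degree_monomial_le _ _).trans_lt
      (by exact_mod_cast ((hI.mem_iff p.1 p.2).1 hp).2)
  · exact zero_mem _

/-- The coefficient of `s^β` in `bξ` comes from that of `s^(β-1)` in `ξ`, hence has degree less than
`d (β - 1)`, below the range of `j` recorded in `I`. -/
theorem symbol_opB {ξ : Xi} (h : ξ ∈ logBounded d hI.mono) : symbol I (Xi.opB ξ) = 0 := by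
  ext p
  rw [symbol_apply, Xi.coeff_opB, coeff_eq_zero_of_mem_degreeLT (logInv_mem_degreeLT _ (h _))
    ((hI.mem_iff p.1.1 p.1.2).1 p.2).1, mul_zero, Pi.zero_apply]

/-- A zero symbol lowers the degree bound at `β` from `d β` to `d (β - 1)`; shifting the exponent
back, `dξ/ds` satisfies the bound `d`. With `symbol_opB`, this identifies the kernel of `symbol` on
`L` with `bL`. -/
theorem exists_opB_of_symbol {ξ : Xi} (h : ξ ∈ logBounded d hI.mono) (h0 : symbol I ξ = 0) :
    ∃ η ∈ logBounded d hI.mono, Xi.opB η = ξ := by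
  have key : ∀ β, Xi.coeff β ξ ∈ Polynomial.degreeLT ℂ (d (β - 1)) := by
    intro β
    refine mem_degreeLT_of_coeff fun j hj => ?_
    rcases lt_or_ge j (d β) with hj' | hj'
    · have hβ : -1 < β := by
        by_contra hβ
        rw [hI.eq_zero β (not_lt.1 hβ)] at hj'
        exact absurd hj' (Nat.not_lt_zero _)
      have := congr_fun h0 ⟨(⟨β, hβ⟩, j), (hI.mem_iff _ _).2 ⟨hj, hj'⟩⟩
      rw [symbol_apply, Pi.zero_apply, mul_eq_zero] at this
      exact this.resolve_left (Nat.cast_ne_zero.2 (Nat.factorial_ne_zero j))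
    · exact coeff_eq_zero_of_mem_degreeLT (h β) hj'
  -- For `β ≤ 0` the bound `d (β - 1)` is zero, so the coefficient of `s^β` vanishes.
  obtain ⟨η, hη, hη'⟩ := exists_opB_eq (ξ := ξ) fun β hβ => by
    have := key β
    rw [hI.eq_zero (β - 1) (by linarith), Polynomial.mem_degreeLT] at this
    simpa using this
  refine ⟨η, fun β => ?_, hη⟩
  have := key (β + 1)
  rw [add_sub_cancel_right] at this
  rw [hη']
  exact add_mem (Submodule.smul_mem _ _ this) (derivative_mem_degreeLT this)

/-- The factor `j + 1` produced by the derivative in `Log s` turns `j!` into `(j + 1)!`. If `(α, j +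
1)` is not in `I` although `(α, j)` is, then `j + 1 ≥ d α` and the neighbouring coefficient
vanishes, so nothing is lost. -/
theorem symbol_binvA {ξ : Xi} (h : ξ ∈ logBounded d hI.mono) :
    symbol I (Xi.binvA ξ) = symbolOp I (symbol I ξ) := by
  classical
  ext p
  have h1 : symbolOp I (symbol I ξ) p = ((p.1.1.1 : ℂ) + 1) * symbol I ξ p +
      if h : (p.1.1, p.1.2 + 1) ∈ I then symbol I ξ ⟨_, h⟩ else 0 := by
    rw [symbolOp, LinearMap.pi_apply, LinearMap.add_apply]
    congr 1
    split_ifs <;> rfl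
  rw [h1]
  have h2 : (if h : (p.1.1, p.1.2 + 1) ∈ I then symbol I ξ ⟨_, h⟩ else 0) =
      (Nat.factorial (p.1.2 + 1) : ℂ) * (Xi.coeff p.1.1.1 ξ).coeff (p.1.2 + 1) := by
    split_ifs with h3
    · rfl
    · rw [coeff_eq_zero_of_mem_degreeLT (h _), mul_zero]
      rw [hI.mem_iff] at h3
      have := ((hI.mem_iff p.1.1 p.1.2).1 p.2).1
      by_contra h4
      exact h3 ⟨by omega, by omega⟩
  rw [h2, symbol_apply, symbol_apply, Xi.coeff_binvA, Polynomial.coeff_add,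
    Polynomial.coeff_smul, Polynomial.coeff_derivative, Nat.factorial_succ, smul_eq_mul]
  push_cast
  ring

theorem symbol_powerSeries_smul (T : PowerSeries ℂ) {ξ : Xi} (h : ξ ∈ logBounded d hI.mono) :
    symbol I (T • ξ) = PowerSeries.constantCoeff T • symbol I ξ := by
  obtain ⟨T', hT'⟩ := exists_powerSeries_smul_eq T
  rw [hT', map_add, map_smul, hI.symbol_opB (powerSeries_smul_mem _ T' h), add_zero]

/-- One step of the `b`-adic expansion: the symbol gives the digit, and the remainder is divisible
by `b` inside the submodule. -/
theorem exists_eq_sum_add_opB {ξ : Xi} (h : ξ ∈ logBounded d hI.mono) :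
    ∃ c : I → ℂ, ∃ η ∈ logBounded d hI.mono,
      ξ = ∑ p, c p • logMonomial p.1.1 p.1.2 + Xi.opB η := by
  have hs : ∑ p, symbol I ξ p • logMonomial p.1.1 p.1.2 ∈ logBoundedC d :=
    Submodule.sum_mem _ fun p _ => Submodule.smul_mem _ _ (hI.logMonomial_mem p.2)
  obtain ⟨η, hη, hη'⟩ := hI.exists_opB_of_symbol
    (ξ := ξ - ∑ p, symbol I ξ p • logMonomial p.1.1 p.1.2) ((logBoundedC d).sub_mem h hs)
    (by rw [map_sub, symbol_sum, sub_self])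
  exact ⟨symbol I ξ, η, hη, by rw [hη']; abel⟩

end IsProfile

/-- The `ℂ[[b]]`-linear combinations of the `s^β (Log s)^j / j!` for `(β, j) ∈ I`. -/
def combination (I : Finset (Exponent × ℕ)) : (I → PowerSeries ℂ) →ₗ[PowerSeries ℂ] Xi :=
  Fintype.linearCombination (PowerSeries ℂ) fun p : I => logMonomial p.1.1 p.1.2

theorem combination_apply (I : Finset (Exponent × ℕ)) (T : I → PowerSeries ℂ) :
    combination I T = ∑ p, T p • logMonomial p.1.1 p.1.2 := rfl

namespace IsProfile

variable {d : ℚ → ℕ} {I : Finset (Exponent × ℕ)} (hI : IsProfile d I)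

include hI

theorem combination_mem (T : I → PowerSeries ℂ) : combination I T ∈ logBounded d hI.mono :=
  Submodule.sum_mem _ fun p _ => powerSeries_smul_mem _ _ (hI.logMonomial_mem p.2)

theorem symbol_combination (T : I → PowerSeries ℂ) :
    symbol I (combination I T) = fun p => PowerSeries.constantCoeff (T p) := by
  classical
  rw [combination_apply, map_sum]
  simp only [hI.symbol_powerSeries_smul _ (hI.logMonomial_mem (Subtype.prop _)),
    symbol_logMonomial]
  exact (pi_eq_sum_univ' _).symm

/-- The symbol of a relation shows that all its constant terms vanish; as `b` is injective, the
relation can be divided by `X`, and so on indefinitely. -/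
theorem combination_injective : Function.Injective (combination I) := by
  rw [injective_iff_map_eq_zero]
  intro T hT
  have key : ∀ N : ℕ, ∃ T' : I → PowerSeries ℂ,
      T = (PowerSeries.X : PowerSeries ℂ) ^ N • T' ∧ combination I T' = 0 := by
    intro N
    induction N with
    | zero => exact ⟨T, by simp, hT⟩
    | succ N ih =>
      obtain ⟨T', h, h'⟩ := ih
      have h0 : ∀ p, (PowerSeries.X : PowerSeries ℂ) ∣ T' p := fun p => by
        have := congr_fun (hI.symbol_combination T') p
        rw [h', map_zero] at this
        exact PowerSeries.X_dvd_iff.2 this.symm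
      choose T'' hT'' using h0
      have e : T' = (PowerSeries.X : PowerSeries ℂ) • T'' := funext hT''
      refine ⟨T'', by rw [h, e, smul_smul, pow_succ], ?_⟩
      rw [e, map_smul, Xi.X_smul] at h'
      exact Xi.opB_injective (h'.trans (map_zero _).symm)
  ext p n
  obtain ⟨T', h, -⟩ := key (n + 1)
  rw [h, Pi.smul_apply, smul_eq_mul, PowerSeries.coeff_X_pow_mul', if_neg (by omega)]
  simp

theorem range_combination :
    LinearMap.range (combination I) =
      (logBounded d hI.mono).restrictScalars (PowerSeries ℂ) := by
  apply le_antisymm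
  · rintro _ ⟨T, rfl⟩
    exact hI.combination_mem T
  · intro ξ hξ
    choose c η hη hc using fun ξ : logBounded d hI.mono => hI.exists_eq_sum_add_opB ξ.2
    -- `x n` is the `n`-th successive quotient by `b`, and `T N` is the series of digits from the
    -- `N`-th on. As the limit `T 0` is explicit, separatedness of `Ξ` for the `b`-adic filtration
    -- replaces a completeness argument.
    let x : ℕ → logBounded d hI.mono := fun n => (fun ζ => ⟨η ζ, hη ζ⟩)^[n] ⟨ξ, hξ⟩
    let T : ℕ → I → PowerSeries ℂ := fun N p => PowerSeries.mk fun n => c (x (n + N)) p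
    have hx : ∀ n, (x (n + 1)).1 = η (x n) := fun n => by
      simp only [x, Function.iterate_succ_apply']
    have hT : ∀ N p, T N p = PowerSeries.C (c (x N) p) + PowerSeries.X * T (N + 1) p := by
      intro N p
      ext n
      cases n with
      | zero => simp [T]
      | succ n =>
        rw [map_add, PowerSeries.coeff_succ_X_mul, PowerSeries.coeff_C, if_neg (by omega),
          zero_add, PowerSeries.coeff_mk, PowerSeries.coeff_mk, add_right_comm, add_assoc]
    have step : ∀ N, (x N).1 - combination I (T N) =
        Xi.opB ((x (N + 1)).1 - combination I (T (N + 1))) := by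
      intro N
      have e : combination I (T N) = ∑ p, c (x N) p • logMonomial p.1.1 p.1.2 +
          Xi.opB (combination I (T (N + 1))) := by
        simp only [combination_apply, map_sum, ← Finset.sum_add_distrib]
        refine Finset.sum_congr rfl fun p _ => ?_
        rw [hT, add_smul, C_smul, mul_smul, Xi.X_smul]
      rw [e, map_sub, hx]
      nth_rewrite 1 [hc (x N)]
      abel
    refine ⟨T 0, (sub_eq_zero.1 (Xi.opB_sep _ fun N => ⟨(x N).1 - combination I (T N), ?_⟩)).symm⟩
    induction N with
    | zero => rfl
    | succ N ih => rw [ih, step, pow_succ, Module.End.mul_apply]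

/-- The basis of the submodule given by the bound `d`. -/
def equiv : (I → PowerSeries ℂ) ≃ₗ[PowerSeries ℂ]
    (logBounded d hI.mono).restrictScalars (PowerSeries ℂ) :=
  (LinearEquiv.ofInjective _ hI.combination_injective).trans
    (LinearEquiv.ofEq _ _ hI.range_combination)

theorem finite : Module.Finite (PowerSeries ℂ)
    ((logBounded d hI.mono).restrictScalars (PowerSeries ℂ)) :=
  Module.Finite.equiv hI.equiv

theorem free : Module.Free (PowerSeries ℂ)
    ((logBounded d hI.mono).restrictScalars (PowerSeries ℂ)) :=
  Module.Free.of_equiv hI.equiv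

theorem finrank : Module.finrank (PowerSeries ℂ)
    ((logBounded d hI.mono).restrictScalars (PowerSeries ℂ)) = I.card := by
  rw [← hI.equiv.finrank_eq, Module.finrank_fintype_fun_eq_card, Fintype.card_coe]

end IsProfile

theorem symbolOp_apply [DecidableEq (Exponent × ℕ)] (I : Finset (Exponent × ℕ)) (v : I → ℂ)
    (p : I) : symbolOp I v p = ((p.1.1.1 : ℂ) + 1) * v p +
      if h : (p.1.1, p.1.2 + 1) ∈ I then v ⟨_, h⟩ else 0 := by
  rw [symbolOp, LinearMap.pi_apply, LinearMap.add_apply]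
  congr 1
  split_ifs <;> rfl

theorem symbol_logMonomial_of_notMem (I : Finset (Exponent × ℕ)) {α : Exponent} {j : ℕ}
    (h : (α, j) ∉ I) : symbol I (logMonomial α j) = 0 := by
  ext p
  rw [symbol_apply, coeff_logMonomial, Pi.zero_apply]
  split_ifs with h1
  · rw [Polynomial.coeff_monomial, if_neg, mul_zero]
    rintro rfl
    apply h
    rw [← Subtype.ext h1]
    exact p.2
  · rw [Polynomial.coeff_zero, mul_zero]

/-! ## The operator on the symbols -/

/-- An injective `f` transports the order of `κ` to the indices, and the blocks have size one. -/
theorem charpoly_of_blockTriangular_injective {ι κ R : Type*} [Fintype ι] [DecidableEq ι]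
    [LinearOrder κ] [CommRing R] {M : Matrix ι ι R} {f : ι → κ} (hf : Function.Injective f)
    (h : M.BlockTriangular f) :
    M.charpoly = ∏ i, (Polynomial.X - Polynomial.C (M i i)) := by
  let _ : LinearOrder ι := LinearOrder.lift' f hf
  have h' : M.BlockTriangular id := fun i j hij => h hij
  convert Matrix.charpoly_of_isUpperTriangular M h'

/-- For the lexicographic order on (exponent, power of `Log s`), the only off-diagonal entries link
`(α, j)` to `(α, j + 1)`, so the matrix is triangular. -/
theorem charpoly_neg_symbolOp (I : Finset (Exponent × ℕ)) :
    (-symbolOp I).charpoly =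
      ∏ p ∈ I, (Polynomial.X - Polynomial.C (-((p.1.1 : ℂ) + 1))) := by
  classical
  have hM : ∀ p q : I, LinearMap.toMatrix' (-symbolOp I) p q =
      -(((p.1.1.1 : ℂ) + 1) * (Pi.single q 1 : I → ℂ) p +
        if h : (p.1.1, p.1.2 + 1) ∈ I then (Pi.single q 1 : I → ℂ) ⟨_, h⟩ else 0) := by
    intro p q
    rw [LinearMap.toMatrix'_apply, LinearMap.neg_apply, Pi.neg_apply, symbolOp_apply]
  have hne : ∀ (p : I) (h : (p.1.1, p.1.2 + 1) ∈ I),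
      toLex p.1 < toLex (⟨_, h⟩ : I).1 := by
    intro p h
    rw [Prod.Lex.toLex_lt_toLex]
    exact Or.inr ⟨rfl, Nat.lt_succ_self _⟩
  have hf : Function.Injective fun p : I => toLex p.1 :=
    fun p q h => Subtype.ext (toLex.injective h)
  have hne' : ∀ {p q : I}, toLex p.1 < toLex q.1 → q ≠ p := by
    rintro p _ h rfl
    exact lt_irrefl _ h
  rw [← LinearMap.charpoly_toMatrix (-symbolOp I) (Pi.basisFun ℂ I),
    LinearMap.toMatrix_eq_toMatrix', charpoly_of_blockTriangular_injective hf,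
    ← Finset.prod_coe_sort I fun p => Polynomial.X - Polynomial.C (-((p.1.1 : ℂ) + 1))]
  · refine Finset.prod_congr rfl fun p _ => ?_
    rw [hM, Pi.single_eq_same, mul_one]
    congr 3
    split_ifs with h
    · rw [Pi.single_eq_of_ne (hne' (hne p h)), add_zero]
    · rw [add_zero]
  · intro p q (hpq : toLex q.1 < toLex p.1)
    rw [hM, Pi.single_eq_of_ne (hne' hpq), mul_zero, zero_add, neg_eq_zero]
    split_ifs with h
    · exact Pi.single_eq_of_ne (hne' (hpq.trans (hne p h))) _
    · rfl

/-! ## The saturation of a submodule -/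

theorem subset_saturation (E : Submodule ATilde Xi) : (E : Set Xi) ⊆ saturation E := by
  intro ξ hξ
  rw [SetLike.mem_coe, saturation, Submodule.mem_sInf]
  exact fun F hF => hF.1 hξ

theorem opB_pow_eq_smul (n : ℕ) (ξ : Xi) :
    (Xi.opB ^ n) ξ = (PowerSeries.X : PowerSeries ℂ) ^ n • ξ := by
  induction n with
  | zero => simp
  | succ n ih => rw [pow_succ', Module.End.mul_apply, ih, ← Xi.X_smul, smul_smul, pow_succ']

/-- The elements sent into `E` by some power of `b` form a `ℂ[[b]]`-submodule containing `E`. It is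
stable by `b⁻¹a` since `bⁿ⁺¹(b⁻¹a) = bⁿa = abⁿ - n bⁿ⁺¹`, hence it contains `E♯`. -/
theorem exists_opB_pow_mem (E : Submodule ATilde Xi) {ξ : Xi} (h : ξ ∈ saturation E) :
    ∃ n : ℕ, (Xi.opB ^ n) ξ ∈ E := by
  have hup : ∀ {ξ : Xi} {m n : ℕ}, m ≤ n → (Xi.opB ^ m) ξ ∈ E → (Xi.opB ^ n) ξ ∈ E := by
    intro ξ m n hmn hm
    rw [← Nat.sub_add_cancel hmn, pow_add, Module.End.mul_apply, opB_pow_eq_smul (n - m)]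
    exact powerSeries_smul_mem _ _ hm
  let F : Submodule (PowerSeries ℂ) Xi :=
    { carrier := {ξ | ∃ n : ℕ, (Xi.opB ^ n) ξ ∈ E}
      zero_mem' := ⟨0, by rw [map_zero]; exact zero_mem E⟩
      add_mem' := by
        rintro ξ η ⟨m, hm⟩ ⟨n, hn⟩
        refine ⟨max m n, ?_⟩
        rw [map_add]
        exact add_mem (hup (le_max_left _ _) hm) (hup (le_max_right _ _) hn)
      smul_mem' := by
        rintro T ξ ⟨n, hn⟩
        refine ⟨n, ?_⟩
        rw [opB_pow_eq_smul] at hn ⊢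
        rw [smul_comm]
        exact powerSeries_smul_mem _ _ hn }
  rw [saturation, Submodule.mem_sInf] at h
  refine h F ⟨fun ξ hξ => ⟨0, hξ⟩, ?_⟩
  rintro ξ ⟨n, hn⟩
  refine ⟨n + 1, ?_⟩
  have h1 : (Xi.opB ^ (n + 1)) (Xi.binvA ξ) =
      Xi.opA ((Xi.opB ^ n) ξ) - (n : ℂ) • (Xi.opB ^ (n + 1)) ξ := by
    rw [comm_pow _ _ Xi.opA_opB, add_sub_cancel_right, pow_succ, Module.End.mul_apply,
      Xi.opB_binvA]
  rw [h1, ← Xi.a_smul, ← C_smul]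
  exact sub_mem (E.smul_mem _ hn) (powerSeries_smul_mem _ _ (hup (Nat.le_succ n) hn))

/-! ### Cyclic vectors for the operator on the symbols. -/

namespace IsProfile

variable {d : ℚ → ℕ} {I : Finset (Exponent × ℕ)} (hI : IsProfile d I)

include hI

/-- A vector with nonzero coefficient on the last vector of each Jordan block is cyclic. -/
theorem eq_top_of_symbolOp_mem {V : Submodule ℂ (I → ℂ)} (hV : ∀ v ∈ V, symbolOp I v ∈ V)
    {v : I → ℂ} (hv : v ∈ V) (hv' : ∀ p : I, p.1.2 + 1 = d p.1.1.1 → v p ≠ 0) : V = ⊤ := by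
  by_contra hne
  have : Nontrivial ((I → ℂ) ⧸ V) := Submodule.Quotient.nontrivial_iff.2 hne
  -- Dual argument: if `V` is proper, the transpose acting on the dual of the quotient has an
  -- eigenvector, that is, a nonzero linear form `f` killing `V` with `f ∘ symbolOp = μ f`.
  obtain ⟨μ, hμ⟩ := Module.End.exists_eigenvalue
    (LinearMap.dualMap (V.mapQ V (symbolOp I) hV) : Module.End ℂ (Module.Dual ℂ ((I → ℂ) ⧸ V)))
  obtain ⟨g, hg⟩ := hμ.exists_hasEigenvector
  set f : (I → ℂ) →ₗ[ℂ] ℂ := g.comp V.mkQ with hf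
  have hfD : ∀ w, f (symbolOp I w) = μ * f w := fun w =>
    LinearMap.congr_fun hg.apply_eq_smul (V.mkQ w)
  have hfV : f v = 0 := by
    rw [hf, LinearMap.comp_apply, Submodule.mkQ_apply, (Submodule.Quotient.mk_eq_zero V).2 hv,
      map_zero]
  have hrel0 : ∀ α : Exponent, (α, 0) ∈ I → ((α.1 : ℂ) + 1) * f (symbol I (logMonomial α 0)) =
      μ * f (symbol I (logMonomial α 0)) := fun α h => by
    rw [← hfD, ← hI.symbol_binvA (hI.logMonomial_mem h), binvA_logMonomial_zero]
    simp
  have hrel : ∀ (α : Exponent) (j : ℕ), (α, j + 1) ∈ I →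
      ((α.1 : ℂ) + 1) * f (symbol I (logMonomial α (j + 1))) + f (symbol I (logMonomial α j)) =
      μ * f (symbol I (logMonomial α (j + 1))) := fun α j h => by
    rw [← hfD, ← hI.symbol_binvA (hI.logMonomial_mem h), binvA_logMonomial_succ]
    simp
  -- Going up a block of eigenvalue other than `μ`, `f` vanishes on each vector in turn; a monomial
  -- below the block has zero symbol.
  have hother : ∀ α : Exponent, (α.1 : ℂ) + 1 ≠ μ → ∀ j, f (symbol I (logMonomial α j)) = 0 := by
    intro α hα j
    by_cases hj : (α, j) ∈ I
    · induction j with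
      | zero => exact (mul_eq_mul_right_iff.1 (hrel0 α hj)).resolve_left hα
      | succ j ih =>
        have h0 : f (symbol I (logMonomial α j)) = 0 := by
          by_cases h : (α, j) ∈ I
          · exact ih h
          · rw [symbol_logMonomial_of_notMem I h, map_zero]
        have := hrel α j hj
        rw [h0, add_zero] at this
        exact (mul_eq_mul_right_iff.1 this).resolve_left hα
    · rw [symbol_logMonomial_of_notMem I hj, map_zero]
  -- In the block of eigenvalue `μ`, the relation at `j + 1` reduces to the vanishing of `f` at `j`,
  -- so only the top vector can survive.
  have hlow : ∀ (α : Exponent) (j : ℕ), (α, j) ∈ I → j + 1 ≠ d α.1 →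
      f (symbol I (logMonomial α j)) = 0 := by
    intro α j hj hjd
    by_cases hα : (α.1 : ℂ) + 1 = μ
    · have h1 := (hI.mem_iff α j).1 hj
      have := hrel α j ((hI.mem_iff α (j + 1)).2 ⟨by omega, by omega⟩)
      rwa [hα, add_eq_left] at this
    · exact hother α hα j
  have hsum : ∀ w : I → ℂ, f w = ∑ p : I, w p * f (symbol I (logMonomial p.1.1 p.1.2)) :=
    fun w => by
    conv_lhs => rw [← symbol_sum I w]
    simp
  have hzero : ∀ p : I, f (symbol I (logMonomial p.1.1 p.1.2)) = 0 := by
    intro p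
    by_cases hp : p.1.2 + 1 = d p.1.1.1
    · by_cases hα : (p.1.1.1 : ℂ) + 1 = μ
      -- Distinct exponents give distinct eigenvalues, so `f v` is the single product `v p * f
      -- (e_p)`, and `v p ≠ 0`.
      · rw [hsum, Finset.sum_eq_single p] at hfV
        · exact (mul_eq_zero.1 hfV).resolve_left (hv' p hp)
        · intro q _ hqp
          by_cases hq : q.1.2 + 1 = d q.1.1.1
          · rw [hother, mul_zero]
            rintro hα'
            apply hqp
            rw [← hα, add_left_inj, Rat.cast_inj] at hα'
            rw [hα', ← hp] at hq
            exact Subtype.ext (Prod.ext (Subtype.ext hα') (Nat.succ_injective hq))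
          · rw [hlow _ _ q.2 hq, mul_zero]
        · exact fun h => (h (Finset.mem_univ p)).elim
      · exact hother _ hα _
    · exact hlow _ _ p.2 hp
  apply hg.2
  refine LinearMap.ext fun x => ?_
  obtain ⟨w, rfl⟩ := V.mkQ_surjective x
  change f w = 0
  rw [hsum]
  exact Finset.sum_eq_zero fun p _ => by rw [hzero, mul_zero]

/-! ## The saturation of a cyclic module -/

variable {φ : Xi} (hφ : φ ∈ logBounded d hI.mono)
  (htop : ∀ p ∈ I, p.2 + 1 = d p.1.1 → (Xi.coeff p.1.1 φ).coeff p.2 ≠ 0)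

include hφ

theorem cyclic_le : cyclic φ ≤ logBounded d hI.mono := by
  rw [cyclic, Submodule.span_singleton_le_iff_mem]
  exact hφ

theorem saturation_le :
    saturation (cyclic φ) ≤ (logBounded d hI.mono).restrictScalars (PowerSeries ℂ) :=
  sInf_le ⟨hI.cyclic_le hφ, fun _ h => binvA_mem_logBoundedC h⟩

/-- The inclusion of `Ã φ` in the submodule given by the bound `d`. -/
def inclusion : cyclic φ →ₗ[PowerSeries ℂ]
    (logBounded d hI.mono).restrictScalars (PowerSeries ℂ) where
  toFun ξ := ⟨ξ.1, hI.cyclic_le hφ ξ.2⟩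
  map_add' _ _ := rfl
  map_smul' _ _ := rfl

theorem inclusion_injective : Function.Injective (hI.inclusion hφ) :=
  fun _ _ h => Subtype.ext (congrArg (fun x => x.1) h)

theorem isABModule : IsABModule (cyclic φ) := by
  have := hI.finite
  have := hI.free
  obtain ⟨n, ⟨B⟩⟩ := Submodule.nonempty_basis_of_pid
    (Module.Free.chooseBasis (PowerSeries ℂ)
      ((logBounded d hI.mono).restrictScalars (PowerSeries ℂ)))
    (LinearMap.range (hI.inclusion hφ))
  exact ⟨Module.Free.of_basis (B.map
      (LinearEquiv.ofInjective _ (hI.inclusion_injective hφ)).symm),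
    Module.Finite.of_injective _ (hI.inclusion_injective hφ)⟩

include htop

theorem map_symbol_satC : (satC (cyclic φ)).map (symbol I) = ⊤ := by
  refine hI.eq_top_of_symbolOp_mem (v := symbol I φ) ?_ ?_ fun p hp => ?_
  · rintro _ ⟨ξ, hξ, rfl⟩
    rw [← hI.symbol_binvA (hI.saturation_le hφ hξ)]
    exact Submodule.mem_map_of_mem (binvA_mem_saturation (cyclic φ) hξ)
  · exact Submodule.mem_map_of_mem
      (subset_saturation (cyclic φ) (Submodule.mem_span_singleton_self φ))
  · rw [symbol_apply]
    exact mul_ne_zero (Nat.cast_ne_zero.2 (Nat.factorial_ne_zero _)) (htop p.1 p.2 hp)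

/-- Nakayama over the local ring `ℂ[[b]]`: `E♯` and `L` have the same image modulo `bL`, and `L` is
of finite type. -/
theorem saturation_eq :
    saturation (cyclic φ) = (logBounded d hI.mono).restrictScalars (PowerSeries ℂ) := by
  refine le_antisymm (hI.saturation_le hφ) ?_
  refine Submodule.le_of_le_smul_of_le_jacobson_bot
    (I := IsLocalRing.maximalIdeal (PowerSeries ℂ)) (Module.Finite.iff_fg.1 hI.finite)
    (IsLocalRing.jacobson_eq_maximalIdeal _ bot_ne_top).ge fun ξ hξ => ?_
  have : symbol I ξ ∈ (satC (cyclic φ)).map (symbol I) := by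
    rw [hI.map_symbol_satC hφ htop]; trivial
  obtain ⟨ζ, hζ, hζξ⟩ := this
  obtain ⟨η, hη, hη'⟩ := hI.exists_opB_of_symbol (ξ := ξ - ζ)
    (sub_mem hξ (hI.saturation_le hφ hζ)) (by rw [map_sub, hζξ, sub_self])
  rw [← sub_add_cancel ξ ζ, add_comm, ← hη', ← Xi.X_smul]
  refine Submodule.add_mem_sup hζ (Submodule.smul_mem_smul ?_ hη)
  rw [IsLocalRing.mem_maximalIdeal, mem_nonunits_iff]
  exact PowerSeries.X_prime.not_isUnit

theorem isRegular : IsRegular (cyclic φ) := by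
  rw [IsRegular, hI.saturation_eq hφ htop]
  exact hI.finite

/-- `b^N L ⊆ E ⊆ L` for some `N`, and multiplication by `b^N` is injective, so the two ranks agree.
-/
theorem rank_eq : rank (cyclic φ) = I.card := by
  have := hI.finite
  have : Module.Finite (PowerSeries ℂ) (cyclic φ) := (hI.isABModule hφ).2
  have hex : ∀ p : I, ∃ n : ℕ, (Xi.opB ^ n) (logMonomial p.1.1 p.1.2) ∈ cyclic φ := fun p =>
    exists_opB_pow_mem _ (by
      rw [hI.saturation_eq hφ htop]; exact hI.logMonomial_mem p.2)
  choose n hn using hex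
  -- The sum serves as a common upper bound of the exponents `n p`.
  let N := ∑ p, n p
  have hN : ∀ T : I → PowerSeries ℂ,
      (PowerSeries.X : PowerSeries ℂ) ^ N • combination I T ∈ cyclic φ := by
    intro T
    rw [combination_apply, Finset.smul_sum]
    refine Submodule.sum_mem _ fun p _ => ?_
    have hp : n p ≤ N := Finset.single_le_sum (fun _ _ => Nat.zero_le _) (Finset.mem_univ p)
    rw [smul_comm, ← Nat.sub_add_cancel hp, pow_add, mul_smul, ← opB_pow_eq_smul (n p)]
    exact powerSeries_smul_mem _ _ (powerSeries_smul_mem _ _ (hn p))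
  let κ : (I → PowerSeries ℂ) →ₗ[PowerSeries ℂ] cyclic φ :=
    { toFun := fun T => ⟨((PowerSeries.X : PowerSeries ℂ) ^ N • combination I) T, hN T⟩
      map_add' := fun T T' => Subtype.ext (map_add _ T T')
      map_smul' := fun c T => Subtype.ext (map_smul _ c T) }
  have hκ : Function.Injective κ := by
    rw [injective_iff_map_eq_zero]
    intro T hT
    have h1 : (PowerSeries.X : PowerSeries ℂ) ^ N • combination I T = 0 :=
      congrArg (fun x => x.1) hT
    rw [← map_smul, ← map_zero (combination I)] at h1
    have h2 := hI.combination_injective h1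
    funext p
    exact (mul_eq_zero.1 (congr_fun h2 p)).resolve_left (pow_ne_zero _ PowerSeries.X_ne_zero)
  apply le_antisymm
  · rw [rank, ← hI.finrank]
    exact LinearMap.finrank_le_finrank_of_injective (hI.inclusion_injective hφ)
  · have := LinearMap.finrank_le_finrank_of_injective hκ
    rwa [Module.finrank_fintype_fun_eq_card, Fintype.card_coe] at this

/-- The isomorphism of `E♯ / b E♯` with the space of symbols. -/
def quotEquiv : satQuot (cyclic φ) ≃ₗ[ℂ] (I → ℂ) := by
  refine (Submodule.quotEquivOfEq _ _ ?_).trans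
    (LinearMap.quotKerEquivOfSurjective ((symbol I).comp (satC (cyclic φ)).subtype) ?_)
  · apply le_antisymm
    · rintro _ ⟨ξ, rfl⟩
      exact hI.symbol_opB (hI.saturation_le hφ ξ.2)
    · intro ξ hξ
      obtain ⟨η, hη, hη'⟩ := hI.exists_opB_of_symbol (hI.saturation_le hφ ξ.2) hξ
      refine ⟨⟨η, ?_⟩, Subtype.ext hη'⟩
      change η ∈ saturation (cyclic φ)
      -- The equality `E♯ = L` is needed here: division by `b` is only known to stay inside `L`.
      rw [hI.saturation_eq hφ htop]
      exact hη
  · rw [← LinearMap.range_eq_top, LinearMap.range_comp, Submodule.range_subtype]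
    exact hI.map_symbol_satC hφ htop

theorem quotEquiv_mk (ξ : satC (cyclic φ)) :
    hI.quotEquiv hφ htop (Submodule.Quotient.mk ξ) = symbol I ξ.1 := rfl

theorem bernstein_eq : bernstein (cyclic φ) =
    ∏ p ∈ I, (Polynomial.X - Polynomial.C (-((p.1.1 : ℂ) + 1))) := by
  have hfin : Module.Finite ℂ (satQuot (cyclic φ)) :=
    Module.Finite.equiv (hI.quotEquiv hφ htop).symm
  rw [bernstein, dif_pos hfin, ← charpoly_neg_symbolOp,
    ← LinearEquiv.charpoly_conj (hI.quotEquiv hφ htop)]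
  congr 1
  refine LinearMap.ext fun v => ?_
  obtain ⟨x, rfl⟩ := (hI.quotEquiv hφ htop).surjective v
  obtain ⟨ξ, rfl⟩ := Submodule.Quotient.mk_surjective _ x
  rw [LinearEquiv.conj_apply_apply, LinearEquiv.symm_apply_apply, LinearMap.neg_apply,
    LinearMap.neg_apply, map_neg, quotEquiv_mk, ← hI.symbol_binvA (hI.saturation_le hφ ξ.2)]
  rfl

end IsProfile

/-! ## The profile of a canonical form -/

open Classical in
/-- The bound on the degrees of the coefficients of the elements of
`⊕_{i ≤ j} ℂ[[s]] s^α (Log s)^i`. -/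
def monomialBound (α : ℚ) (j : ℕ) (β : ℚ) : ℕ := if ∃ k : ℕ, β = α + k then j + 1 else 0

theorem monomialBound_mono (α : ℚ) (j : ℕ) (β : ℚ) :
    monomialBound α j (β - 1) ≤ monomialBound α j β := by
  unfold monomialBound
  split_ifs with h1 h2 <;> try omega
  obtain ⟨k, hk⟩ := h1
  exact (h2 ⟨k + 1, by push_cast; linarith⟩).elim

theorem logMonomial_mem_monomialBound (α : Exponent) (j : ℕ) :
    logMonomial α j ∈ logBounded (monomialBound α.1 j) (monomialBound_mono α.1 j) := by
  rw [mem_logBounded]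
  intro β
  rw [coeff_logMonomial]
  split_ifs with h
  · rw [monomialBound, if_pos ⟨0, by simp [h]⟩, Polynomial.mem_degreeLT]
    exact (Polynomial.degree_monomial_le _ _).trans_lt (by exact_mod_cast Nat.lt_succ_self j)
  · exact zero_mem _

theorem coeff_smul_logMonomial_mem (T : PowerSeries ℂ) (α : Exponent) (j : ℕ) (β : ℚ) :
    Xi.coeff β (T • logMonomial α j) ∈ Polynomial.degreeLT ℂ (monomialBound α.1 j β) :=
  powerSeries_smul_mem _ T (logMonomial_mem_monomialBound α j) β

theorem coeff_smul_logMonomial_of_forall_ne (T : PowerSeries ℂ) {α : Exponent} (j : ℕ) {β : ℚ}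
    (h : ∀ k : ℕ, β ≠ α.1 + k) : Xi.coeff β (T • logMonomial α j) = 0 := by
  have := coeff_smul_logMonomial_mem T α j β
  rw [monomialBound, if_neg (by simpa using h), Polynomial.mem_degreeLT] at this
  simpa using this

/-- Positive powers of `b` raise the exponent, so only the constant term of `T` reaches `s^α`. -/
theorem coeff_smul_logMonomial_self (T : PowerSeries ℂ) (α : Exponent) (j : ℕ) :
    Xi.coeff α.1 (T • logMonomial α j) =
      Polynomial.monomial j (PowerSeries.constantCoeff T * (Nat.factorial j : ℂ)⁻¹) := by
  obtain ⟨T', hT'⟩ := exists_powerSeries_smul_eq T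
  rw [hT', map_add, map_smul, coeff_logMonomial, if_pos rfl, Xi.coeff_opB,
    coeff_smul_logMonomial_of_forall_ne, map_zero, add_zero, Polynomial.smul_monomial,
    smul_eq_mul]
  intro k hk
  have : (0 : ℚ) ≤ k := Nat.cast_nonneg k
  linarith

theorem coeff_smul_logMonomial_eq_zero (T : PowerSeries ℂ) (α : Exponent) {i j : ℕ} (h : i < j)
    (β : ℚ) : (Xi.coeff β (T • logMonomial α i)).coeff j = 0 := by
  refine coeff_eq_zero_of_mem_degreeLT (coeff_smul_logMonomial_mem T α i β) ?_
  unfold monomialBound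
  split_ifs <;> omega

open Classical in
/-- The bound on the degrees of the coefficients given by the terms of a canonical form. -/
def profile (A : Finset (Exponent × ℕ)) (S : Exponent × ℕ → PowerSeries ℂ) (β : ℚ) : ℕ :=
  (A.filter fun p => S p ≠ 0).sup fun p => monomialBound p.1.1 p.2 β

section Profile

variable {A : Finset (Exponent × ℕ)} {S : Exponent × ℕ → PowerSeries ℂ}

theorem lt_profile_iff {β : ℚ} {j : ℕ} : j < profile A S β ↔
    ∃ p ∈ A, S p ≠ 0 ∧ j ≤ p.2 ∧ ∃ k : ℕ, β = p.1.1 + k := by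
  classical
  rw [profile, Finset.lt_sup_iff]
  simp only [Finset.mem_filter, monomialBound]
  constructor
  · rintro ⟨p, ⟨hp, hS⟩, h⟩
    split_ifs at h with hk
    · exact ⟨p, hp, hS, by omega, hk⟩
    · omega
  · rintro ⟨p, hp, hS, hj, hk⟩
    exact ⟨p, ⟨hp, hS⟩, by rw [if_pos hk]; omega⟩

theorem profile_mono (β : ℚ) : profile A S (β - 1) ≤ profile A S β :=
  Finset.sup_mono_fun fun p _ => monomialBound_mono p.1.1 p.2 β

theorem profile_le_add (β : ℚ) (k : ℕ) : profile A S β ≤ profile A S (β + k) := by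
  induction k with
  | zero => simp
  | succ k ih =>
    refine ih.trans ?_
    have := profile_mono (A := A) (S := S) (β + (k + 1 : ℕ))
    rwa [show β + ((k + 1 : ℕ) : ℚ) - 1 = β + k by push_cast; ring] at this

theorem profile_eq_zero {β : ℚ} (hβ : β ≤ -1) : profile A S β = 0 := by
  by_contra h
  obtain ⟨p, -, -, -, k, hk⟩ := lt_profile_iff.1 (Nat.pos_of_ne_zero h)
  have h1 := p.1.2
  have : (0 : ℚ) ≤ k := Nat.cast_nonneg k
  linarith

open Classical in
/-- The indices of the basis of the saturation. -/
def profileIndex (A : Finset (Exponent × ℕ)) (S : Exponent × ℕ → PowerSeries ℂ) :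
    Finset (Exponent × ℕ) :=
  A.filter fun p => profile A S (p.1.1 - 1) ≤ p.2 ∧ p.2 < profile A S p.1.1

/-- A term responsible for a jump of the profile. -/
theorem exists_of_profile_lt {β : ℚ} (h : profile A S (β - 1) < profile A S β) :
    ∃ p ∈ A, S p ≠ 0 ∧ p.1.1 = β ∧ p.2 + 1 = profile A S β := by
  obtain ⟨n, hn⟩ : ∃ n, profile A S β = n + 1 := Nat.exists_eq_succ_of_ne_zero (by omega)
  obtain ⟨p, hp, hS, hj, k, hk⟩ := lt_profile_iff.1 (show n < profile A S β by omega)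
  have h2 : p.2 < profile A S β := lt_profile_iff.2 ⟨p, hp, hS, le_rfl, k, hk⟩
  refine ⟨p, hp, hS, ?_, by omega⟩
  cases k with
  | zero => simpa using hk.symm
  -- A term starting strictly below `β` would already count at `β - 1`, contradicting the jump.
  | succ k =>
    have : p.2 < profile A S (β - 1) :=
      lt_profile_iff.2 ⟨p, hp, hS, le_rfl, k, by rw [hk]; push_cast; ring⟩
    omega

end Profile

/-! ### Leading coefficients of a canonical form. -/

namespace IsCanonicalForm

variable {φ : Xi} {A : Finset (Exponent × ℕ)} {S : Exponent × ℕ → PowerSeries ℂ}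
  (h : IsCanonicalForm φ A S)

include h

/-- `profileIndex` only retains pairs of `A`, which loses nothing: a jump at `α` comes from a term
`(α, i)` of `A` of maximal `i`, and condition (i) puts all `(α, j)` with `j ≤ i` in `A`. -/
theorem isProfile : IsProfile (profile A S) (profileIndex A S) where
  mono := profile_mono
  eq_zero _ := profile_eq_zero
  mem_iff α j := by
    rw [profileIndex, Finset.mem_filter, and_iff_right_iff_imp]
    rintro ⟨h1, h2⟩
    obtain ⟨p, hp, -, hα, hj⟩ := exists_of_profile_lt (h1.trans_lt h2)
    obtain ⟨β, i⟩ := p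
    obtain rfl : β = α := Subtype.ext hα
    dsimp only at hj h1 h2
    exact h.saturated β i hp j (by omega)

theorem mem_logBounded : φ ∈ logBounded (profile A S) profile_mono := by
  rw [h.eq_sum]
  refine Submodule.sum_mem _ fun p hp => ?_
  by_cases hS : S p = 0
  · rw [hS, zero_smul]; exact zero_mem _
  · intro β
    classical
    exact degreeLT_le (Finset.le_sup (f := fun p : Exponent × ℕ => monomialBound p.1.1 p.2 β)
      (Finset.mem_filter.2 ⟨hp, hS⟩)) (coeff_smul_logMonomial_mem (S p) p.1 p.2 β)

/-- Exactly one term contributes. Other terms at the same exponent have a smaller power of `Log s`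
by maximality, and terms from lower exponents of the class have degree less than `profile A S (α -
1) ≤ j`. By (ii) the remaining constant term is nonzero. -/
theorem coeff_ne_zero {α : Exponent} {j : ℕ} (hα : (α, j) ∈ profileIndex A S)
    (hj : j + 1 = profile A S α.1) : (Xi.coeff α.1 φ).coeff j ≠ 0 := by
  have hlt := (h.isProfile.mem_iff α j).1 hα
  obtain ⟨⟨β, i⟩, hp, hS, hβ, hi⟩ := exists_of_profile_lt (hlt.1.trans_lt hlt.2)
  obtain rfl : β = α := Subtype.ext hβ
  obtain rfl : i = j := Nat.succ_injective (hi.trans hj.symm)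
  have e : (Xi.coeff β.1 φ).coeff i =
      PowerSeries.constantCoeff (S (β, i)) * (Nat.factorial i : ℂ)⁻¹ := by
    rw [h.eq_sum, map_sum, Polynomial.finsetSum_coeff, Finset.sum_eq_single_of_mem _ hp]
    · rw [coeff_smul_logMonomial_self, Polynomial.coeff_monomial, if_pos rfl]
    · rintro ⟨γ, l⟩ hq hne
      by_cases hS' : S (γ, l) = 0
      · rw [hS', zero_smul, map_zero, Polynomial.coeff_zero]
      by_cases hk : ∃ k : ℕ, β.1 = γ.1 + k
      · obtain ⟨k, hk⟩ := hk
        refine coeff_smul_logMonomial_eq_zero _ _ ?_ _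
        cases k with
        | zero =>
          obtain rfl : γ = β := Subtype.ext (by simpa using hk.symm)
          have h1 : l < profile A S γ.1 := lt_profile_iff.2 ⟨(γ, l), hq, hS', le_rfl, 0, hk⟩
          have h2 : l ≠ i := by rintro rfl; exact hne rfl
          omega
        | succ k =>
          have h1 : l < profile A S (β.1 - 1) := lt_profile_iff.2
            ⟨(γ, l), hq, hS', le_rfl, k, by rw [hk]; push_cast; ring⟩
          omega
      · rw [coeff_smul_logMonomial_of_forall_ne _ _ (by simpa using hk), Polynomial.coeff_zero]
  rw [e]
  exact mul_ne_zero ((h.zero_or_unit _ _ hp).resolve_left hS)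
    (inv_ne_zero (Nat.cast_ne_zero.2 (Nat.factorial_ne_zero _)))

end IsCanonicalForm

/-! ## Classes modulo `ℤ` -/

theorem classOf_add_natCast (α : ℚ) (k : ℕ) : classOf (α + k) = classOf α := by
  rw [classOf, classOf, eq_comm, QuotientAddGroup.eq]
  exact ⟨k, by simp⟩

theorem exists_natCast_of_classOf_eq {α β : ℚ} (h : classOf α = classOf β) (hαβ : α ≤ β) :
    ∃ k : ℕ, β = α + k := by
  obtain ⟨n, hn⟩ := QuotientAddGroup.eq.1 h
  simp only [zsmul_eq_mul, mul_one] at hn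
  have hn0 : (0 : ℚ) ≤ n := by rw [hn]; linarith
  obtain ⟨k, rfl⟩ := Int.eq_ofNat_of_zero_le (by exact_mod_cast hn0)
  exact ⟨k, by push_cast at hn; linarith⟩

theorem classOf_neg_add_one (α : ℚ) : classOf (-(α + 1)) = -classOf α := by
  have h1 := classOf_add_natCast (-(α + 1)) 1
  rw [← h1, classOf, classOf, ← QuotientAddGroup.mk_neg]
  congr 1
  push_cast
  ring

/-! ### Counting the basis indices in each class. -/

namespace IsCanonicalForm

variable {φ : Xi} {A : Finset (Exponent × ℕ)} {S : Exponent × ℕ → PowerSeries ℂ}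
  (h : IsCanonicalForm φ A S)

include h

omit h in
theorem le_maxLog {α : Exponent} {j : ℕ} (hα : (α, j) ∈ A)
    (hS : PowerSeries.constantCoeff (S (α, j)) ≠ 0) : j ≤ maxLog A S (classOf α.1) := by
  refine le_csSup ⟨A.sup Prod.snd, ?_⟩ ⟨α, hα, rfl, hS⟩
  rintro i ⟨β, hβ, -, -⟩
  exact Finset.le_sup (f := Prod.snd) hβ

/-- The exponent `Λ⁺`. -/
theorem exists_topExponent {Λ : QModZ} (hΛ : Λ ∈ classes A) : ∃ α : Exponent,
    classOf α.1 = Λ ∧ (α, maxLog A S Λ) ∈ A ∧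
      PowerSeries.constantCoeff (S (α, maxLog A S Λ)) ≠ 0 := by
  classical
  obtain ⟨⟨α, j⟩, hα, rfl⟩ := Finset.mem_image.1 hΛ
  obtain ⟨k, -, hk, hk'⟩ := h.exists_unit α j hα
  have hne : {j : ℕ | ∃ β : Exponent, (β, j) ∈ A ∧ classOf β.1 = classOf α.1 ∧
    PowerSeries.constantCoeff (S (β, j)) ≠ 0}.Nonempty := ⟨k, α, hk, rfl, hk'⟩
  obtain ⟨β, h1, h2, h3⟩ := Nat.sSup_mem hne ⟨A.sup Prod.snd, by
    rintro i ⟨β, hβ, -, -⟩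
    exact Finset.le_sup (f := Prod.snd) hβ⟩
  exact ⟨β, h2, h1, h3⟩

/-- Condition (iv) forbids two such exponents in one class, so the set defining the supremum is a
singleton. -/
theorem topExponent_eq {Λ : QModZ} {α : Exponent} (hα : classOf α.1 = Λ)
    (hA : (α, maxLog A S Λ) ∈ A)
    (hS : PowerSeries.constantCoeff (S (α, maxLog A S Λ)) ≠ 0) :
    topExponent A S Λ = (α.1 : ℝ) := by
  have huniq : ∀ {β γ : Exponent}, classOf β.1 = Λ → (β, maxLog A S Λ) ∈ A →
      PowerSeries.constantCoeff (S (β, maxLog A S Λ)) ≠ 0 → classOf γ.1 = Λ →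
      (γ, maxLog A S Λ) ∈ A → PowerSeries.constantCoeff (S (γ, maxLog A S Λ)) ≠ 0 →
      ¬ β.1 < γ.1 := by
    intro β γ hβ hβA hβS hγ hγA hγS hlt
    obtain ⟨k, hk⟩ := exists_natCast_of_classOf_eq (hβ.trans hγ.symm) hlt.le
    have hk0 : 0 < k := Nat.pos_of_ne_zero (by rintro rfl; simp at hk; linarith)
    have := h.translate_zero β γ _ k hβA (fun h0 => hβS (by rw [h0, map_zero])) hk0 hk hγA
    exact hγS (by rw [this, map_zero])
  have : {x : ℝ | ∃ α : Exponent, x = (α.1 : ℝ) ∧ classOf α.1 = Λ ∧ (α, maxLog A S Λ) ∈ A ∧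
      PowerSeries.constantCoeff (S (α, maxLog A S Λ)) ≠ 0} = {(α.1 : ℝ)} := by
    ext x
    constructor
    · rintro ⟨β, rfl, h1, h2, h3⟩
      rw [Set.mem_singleton_iff, Rat.cast_inj]
      exact le_antisymm (not_lt.1 (huniq hα hA hS h1 h2 h3))
        (not_lt.1 (huniq h1 h2 h3 hα hA hS))
    · rintro rfl
      exact ⟨α, rfl, hα, hA, hS⟩
  rw [topExponent, this, csSup_singleton]

/-- By (ii) every nonzero `S` has nonzero constant term, so the terms defining the profile are
counted by `maxLog`. -/
theorem profile_le (α : ℚ) : profile A S α ≤ maxLog A S (classOf α) + 1 := by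
  by_contra hlt
  obtain ⟨⟨β, i⟩, hp, hS, hj, k, hk⟩ := lt_profile_iff.1 (not_le.1 hlt)
  have := le_maxLog hp ((h.zero_or_unit _ _ hp).resolve_left hS)
  rw [hk, classOf_add_natCast] at hj
  dsimp only at hj this
  omega

/-- If the profile exceeded `n(Λ)` already at `α - 1`, a nonzero term with the same power of `Log s`
would sit at a lower exponent of `Λ`, and (iv) would force `S` to vanish at `α`. -/
theorem top_mem_profileIndex {Λ : QModZ} {α : Exponent} (hα : classOf α.1 = Λ)
    (hA : (α, maxLog A S Λ) ∈ A)
    (hS : PowerSeries.constantCoeff (S (α, maxLog A S Λ)) ≠ 0) :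
    (α, maxLog A S Λ) ∈ profileIndex A S := by
  have hS0 : S (α, maxLog A S Λ) ≠ 0 := fun h0 => hS (by rw [h0, map_zero])
  refine (h.isProfile.mem_iff _ _).2 ⟨?_, lt_profile_iff.2 ⟨_, hA, hS0, le_rfl, 0, by simp⟩⟩
  by_contra hlt
  obtain ⟨⟨β, i⟩, hp, hSi, hj, k, hk⟩ := lt_profile_iff.1 (not_le.1 hlt)
  have hk' : α.1 = β.1 + ((k + 1 : ℕ) : ℚ) := by push_cast; dsimp only at hk; linarith
  have hle := le_maxLog hp ((h.zero_or_unit _ _ hp).resolve_left hSi)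
  rw [← classOf_add_natCast β.1 (k + 1), ← hk', hα] at hle
  obtain rfl : i = maxLog A S Λ := le_antisymm hle hj
  exact hS0 (h.translate_zero β α _ (k + 1) hp hSi (Nat.succ_pos k) hk' hA)

open Classical in
-- Along `Λ` the profile is nondecreasing from `0` to `n(Λ) + 1`, so each `j ≤ n(Λ)` lies in exactly
-- one jump; the bijection is `(β, j) ↦ j`.
theorem card_filter_profileIndex {Λ : QModZ} (hΛ : Λ ∈ classes A) :
    ((profileIndex A S).filter fun p => classOf p.1.1 = Λ).card = maxLog A S Λ + 1 := by
  obtain ⟨α, hα, hA, hS⟩ := h.exists_topExponent hΛ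
  have htop := ((h.isProfile.mem_iff _ _).1 (h.top_mem_profileIndex hα hA hS)).2
  rw [← Finset.card_range (maxLog A S Λ + 1)]
  refine Finset.card_bij (fun p _ => p.2) ?_ ?_ ?_
  · rintro ⟨β, j⟩ hp
    obtain ⟨h1, rfl⟩ := Finset.mem_filter.1 hp
    exact Finset.mem_range.2 (((h.isProfile.mem_iff _ _).1 h1).2.trans_le (h.profile_le _))
  · have key : ∀ {β γ : Exponent} {j : ℕ}, (β, j) ∈ profileIndex A S →
        (γ, j) ∈ profileIndex A S → classOf β.1 = classOf γ.1 → ¬ β.1 < γ.1 := by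
      intro β γ j hβ hγ hc hlt
      obtain ⟨k, hk⟩ := exists_natCast_of_classOf_eq hc hlt.le
      cases k with
      | zero => simp at hk; linarith
      | succ k =>
        have h1 := profile_le_add (A := A) (S := S) β.1 k
        rw [show β.1 + (k : ℚ) = γ.1 - 1 by rw [hk]; push_cast; ring] at h1
        have h2 := ((h.isProfile.mem_iff _ _).1 hβ).2
        have h3 := ((h.isProfile.mem_iff _ _).1 hγ).1
        omega
    rintro ⟨β, j⟩ hp ⟨γ, i⟩ hq (rfl : j = i)
    obtain ⟨h1, h1'⟩ := Finset.mem_filter.1 hp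
    obtain ⟨h2, h2'⟩ := Finset.mem_filter.1 hq
    have hc := h1'.trans h2'.symm
    exact Prod.ext (Subtype.ext (le_antisymm (not_lt.1 (key h2 h1 hc.symm))
      (not_lt.1 (key h1 h2 hc)))) rfl
  · intro j hj
    have hj' : j < profile A S α.1 := by have := Finset.mem_range.1 hj; omega
    -- Descending from `α`, the profile reaches `0` below `-1`. The first `m + 1` steps bringing it
    -- to at most `j` locate the jump across `j` at `α - m`.
    have hex : ∃ m : ℕ, profile A S (α.1 - m) ≤ j := by
      obtain ⟨m, hm⟩ := exists_nat_ge (α.1 + 1)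
      exact ⟨m, by rw [profile_eq_zero (by linarith)]; exact Nat.zero_le _⟩
    obtain ⟨m, hm⟩ : ∃ m, Nat.find hex = m + 1 := Nat.exists_eq_succ_of_ne_zero fun h0 => by
      have := Nat.find_spec hex
      rw [h0, Nat.cast_zero, sub_zero] at this
      omega
    have h1 := Nat.find_spec hex
    have h2 := Nat.find_min hex (m := m) (by omega)
    rw [hm] at h1
    have hgt : -1 < α.1 - m := by
      by_contra hgt
      rw [profile_eq_zero (not_lt.1 hgt)] at h2
      omega
    refine ⟨(⟨α.1 - m, hgt⟩, j), Finset.mem_filter.2 ⟨(h.isProfile.mem_iff _ _).2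
      ⟨?_, not_le.1 h2⟩, ?_⟩, rfl⟩
    · rwa [sub_sub, ← Nat.cast_succ]
    · rw [← classOf_add_natCast _ m, sub_add_cancel, hα]

theorem card_profileIndex :
    (profileIndex A S).card = ∑ Λ ∈ classes A, (maxLog A S Λ + 1) := by
  classical
  rw [Finset.card_eq_sum_card_fiberwise (f := fun p => classOf p.1.1) (t := classes A)]
  · exact Finset.sum_congr rfl fun Λ hΛ => by
      rw [← h.card_filter_profileIndex hΛ]
  · intro p hp
    exact Finset.mem_image_of_mem _ (Finset.mem_filter.1 hp).1

end IsCanonicalForm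

/-- The roots are the rationals `-(α + 1)`, with multiplicity, and `-(α + 1)` lies in the class
opposite to that of `α`. -/
theorem rootsCount_prod (I : Finset (Exponent × ℕ)) (Λ : QModZ) [DecidableEq QModZ] :
    rootsCount (∏ p ∈ I, (Polynomial.X - Polynomial.C (-((p.1.1 : ℂ) + 1)))) (-Λ) =
      (I.filter fun p => classOf p.1.1 = Λ).card := by
  classical
  have hr : (∏ p ∈ I, (Polynomial.X - Polynomial.C (-((p.1.1 : ℂ) + 1)))).roots =
      I.val.map fun p => -((p.1.1 : ℂ) + 1) := by
    rw [Finset.prod_eq_multiset_prod, ← Polynomial.roots_multiset_prod_X_sub_C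
      (I.val.map fun p => -((p.1.1 : ℂ) + 1)), Multiset.map_map]
    rfl
  rw [rootsCount, hr, Multiset.countP_map, Finset.card_def, Finset.filter_val]
  congr 1
  refine Multiset.filter_congr fun p _ => ?_
  constructor
  · rintro ⟨q, hq, hΛ⟩
    have : q = -(p.1.1 + 1) := by
      have : (q : ℂ) = ((-(p.1.1 + 1) : ℚ) : ℂ) := by rw [← hq]; push_cast; ring
      exact_mod_cast this
    rw [this, classOf_neg_add_one, neg_inj] at hΛ
    exact hΛ
  · rintro rfl
    exact ⟨-(p.1.1 + 1), by push_cast; ring, classOf_neg_add_one _⟩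

end ABMod

end

theorem mainTheorem8 (φ : ABMod.Xi) (A : Finset (ABMod.Exponent × ℕ))
    (S : ABMod.Exponent × ℕ → PowerSeries ℂ) (hφ : ABMod.IsCanonicalForm φ A S) :
    ABMod.IsABModule (ABMod.cyclic φ) ∧ ABMod.IsRegular (ABMod.cyclic φ) ∧
    ABMod.rank (ABMod.cyclic φ) = ∑ Λ ∈ ABMod.classes A, (ABMod.maxLog A S Λ + 1) ∧
    ∀ Λ ∈ ABMod.classes A,
      ABMod.rootsCount (ABMod.bernstein (ABMod.cyclic φ)) (-Λ) = ABMod.maxLog A S Λ + 1 ∧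
      (ABMod.bernstein (ABMod.cyclic φ)).IsRoot
        (-(((ABMod.topExponent A S Λ : ℝ) : ℂ) + 1)) := by
  classical
  have hI := hφ.isProfile
  have hmem := hφ.mem_logBounded
  have htop : ∀ p ∈ ABMod.profileIndex A S, p.2 + 1 = ABMod.profile A S p.1.1 →
      (ABMod.Xi.coeff p.1.1 φ).coeff p.2 ≠ 0 := fun _ hp hj => hφ.coeff_ne_zero hp hj
  refine ⟨hI.isABModule hmem, hI.isRegular hmem htop,
    (hI.rank_eq hmem htop).trans hφ.card_profileIndex, fun Λ hΛ => ?_⟩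
  rw [hI.bernstein_eq hmem htop]
  refine ⟨(ABMod.rootsCount_prod _ Λ).trans ?_, ?_⟩
  · rw [← hφ.card_filter_profileIndex hΛ]
  · obtain ⟨α, hα, hA, hS⟩ := hφ.exists_topExponent hΛ
    rw [hφ.topExponent_eq hα hA hS, Polynomial.IsRoot.def, Polynomial.eval_prod]
    exact Finset.prod_eq_zero (hφ.top_mem_profileIndex hα hA hS) (by simp)
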